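/- For an integer $n\ge 1$, two odd measurable functions $F,G:\mathbb{R}^n\to\mathbb{R}$ (i.e. $F(-x)=-F(x)$ and $G(-x)=-G(x)$) and real $t\in(-1,1)$, put $$\Phi_{F,G}(t)=\mathbb{E}\left[\operatorname{sign}(F(X))\,\operatorname{sign}(G(Y))\right],$$ where $X=(X_0,\dots,X_{n-1})$, $Y=(Y_0,\dots,Y_{n-1})$, the pairs $(X_i,Y_i)$, $0\le i\le n-1$, are independent, and each $(X_i,Y_i)$ is a centered Gaussian pair with $\mathbb{E}[X_i^2]=\mathbb{E}[Y_i^2]=1$ and $\mathbb{E}[X_iY_i]=t$. Write $\Phi_{F,G}$ also for the (unique) analytic extension of this function to the strip $\{t\in\mathbb{C}: |\operatorname{Re} t|<1\}$, which contains $i=\sqrt{-1}$. Theorem. There exist an integer $n\ge 1$ and two odd measurable functions $F,G:\mathbb{R}^n\to\mathbb{R}$ such that $\Phi_{F,G}(i)/i$ is a real number and $$\frac{\Phi_{F,G}(i)}{i}>\frac{2}{\pi}\ln\left(1+\sqrt{2}\right).$$ -/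

import Mathlib

open MeasureTheory ProbabilityTheory Filter Topology

noncomputable section

/-- The joint law of `n` independent pairs `(X i, Y i)` of centered normal Gaussian variables
(variance `1`) with `E[X i * Y i] = t`, for `-1 ≤ t ≤ 1`: for a sample point `w`, the coordinates
of the pair `(X i, Y i)` are `w i 0` and `w i 1`. -/
def corrGaussianPairs (n : ℕ) (t : ℝ) : Measure (Fin n → EuclideanSpace ℝ (Fin 2)) :=
  Measure.pi fun _ => multivariateGaussian 0 !![1, t; t, 1]

/-- `E[sign (F X) * sign (G Y)]` for Gaussian vectors `X`, `Y` in `ℝⁿ` whose coordinate pairs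
are independent, each pair being standard normal with correlation `t`. -/
def signCorr {n : ℕ} (F G : (Fin n → ℝ) → ℝ) (t : ℝ) : ℝ :=
  ∫ w, Real.sign (F fun i => w i 0) * Real.sign (G fun i => w i 1) ∂(corrGaussianPairs n t)

/-- The open strip `|Re z| < 1`. -/
def strip : Set ℂ := {z | |z.re| < 1}

/-- `Φ` is the analytic function `Φ_{F,G}` on the strip `|Re z| < 1`: it is analytic there and
equals `E[sign (F X) * sign (G Y)]` at every real correlation `t ∈ (-1, 1)`. -/
structure IsPhi {n : ℕ} (F G : (Fin n → ℝ) → ℝ) (Φ : ℂ → ℂ) : Prop where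
  analyticOnNhd : AnalyticOnNhd ℂ Φ strip
  eq_signCorr : ∀ t : ℝ, |t| < 1 → Φ (t : ℂ) = (signCorr F G t : ℂ)

theorem isPreconnected_strip : IsPreconnected strip := by
  have h : strip = Complex.reLm ⁻¹' (Set.Ioo (-1 : ℝ) 1) := by
    ext z
    simp [strip, abs_lt]
  rw [h]
  exact ((convex_Ioo (-1 : ℝ) 1).linear_preimage Complex.reLm).isPreconnected

/-- `Φ_{F,G}` is determined on the whole strip (which contains `i`) by `F` and `G`. -/
theorem IsPhi.eqOn {n : ℕ} {F G : (Fin n → ℝ) → ℝ} {Φ Ψ : ℂ → ℂ}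
    (hΦ : IsPhi F G Φ) (hΨ : IsPhi F G Ψ) : Set.EqOn Φ Ψ strip := by
  refine hΦ.analyticOnNhd.eqOn_of_preconnected_of_frequently_eq hΨ.analyticOnNhd
    isPreconnected_strip (z₀ := 0) (by simp [strip]) ?_
  have ht : Tendsto (fun x : ℝ => (x : ℂ)) (𝓝[≠] 0) (𝓝[≠] 0) := by
    refine tendsto_nhdsWithin_iff.2 ⟨?_, ?_⟩
    · exact (Complex.continuous_ofReal.tendsto' 0 0 (by simp)).mono_left nhdsWithin_le_nhds
    · filter_upwards [self_mem_nhdsWithin] with x hx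
      simpa using hx
  refine ht.frequently (Eventually.frequently ?_)
  have h1 : ∀ᶠ x : ℝ in 𝓝[≠] 0, |x| < 1 := by
    refine nhdsWithin_le_nhds ?_
    exact (continuous_abs.tendsto' (0 : ℝ) 0 (by simp)).eventually (gt_mem_nhds one_pos)
  filter_upwards [h1] with x hx
  rw [hΦ.eq_signCorr x hx, hΨ.eq_signCorr x hx]

end

/-! ### The density of a correlated Gaussian pair -/

theorem posSemidef_corr {t : ℝ} (ht : |t| < 1) :
    (!![1, t; t, 1] : Matrix (Fin 2) (Fin 2) ℝ).PosSemidef := by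
  have hs : 0 ≤ 1 - t ^ 2 := by
    have := (sq_lt_one_iff_abs_lt_one t).2 ht
    linarith
  have h := Matrix.posSemidef_self_mul_conjTranspose
    (!![1, 0; t, √(1 - t ^ 2)] : Matrix (Fin 2) (Fin 2) ℝ)
  convert h using 1
  ext i j
  fin_cases i <;> fin_cases j <;> simp [Matrix.mul_apply, Fin.sum_univ_two]
  rw [Real.mul_self_sqrt hs]
  ring

/-- A correlated Gaussian pair is a linear image of an independent pair. -/
theorem multivariateGaussian_corr_eq_map {t : ℝ} (ht : |t| < 1) :
    multivariateGaussian 0 !![1, t; t, 1] =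
      (stdGaussian (EuclideanSpace ℝ (Fin 2))).map
        (fun x => !₂[x 0, t * x 0 + √(1 - t ^ 2) * x 1]) := by
  have hs : 0 ≤ 1 - t ^ 2 := by
    have := (sq_lt_one_iff_abs_lt_one t).2 ht
    linarith
  have hm : Measurable fun x : EuclideanSpace ℝ (Fin 2) =>
      (!₂[x 0, t * x 0 + √(1 - t ^ 2) * x 1] : EuclideanSpace ℝ (Fin 2)) := by
    fun_prop
  have : IsProbabilityMeasure ((stdGaussian (EuclideanSpace ℝ (Fin 2))).map
      (fun x => (!₂[x 0, t * x 0 + √(1 - t ^ 2) * x 1] : EuclideanSpace ℝ (Fin 2)))) :=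
    Measure.isProbabilityMeasure_map hm.aemeasurable
  apply Measure.ext_of_charFun
  ext u
  have key : charFun ((stdGaussian (EuclideanSpace ℝ (Fin 2))).map
      (fun x => (!₂[x 0, t * x 0 + √(1 - t ^ 2) * x 1] : EuclideanSpace ℝ (Fin 2)))) u =
      charFun (stdGaussian (EuclideanSpace ℝ (Fin 2)))
        !₂[u 0 + t * u 1, √(1 - t ^ 2) * u 1] := by
    rw [charFun_apply, charFun_apply, integral_map hm.aemeasurable (by fun_prop)]
    congr with x
    simp [PiLp.inner_apply, Fin.sum_univ_two]
    ring_nf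
  rw [key, charFun_stdGaussian, charFun_multivariateGaussian (posSemidef_corr ht),
    ← Complex.ofReal_pow, EuclideanSpace.real_norm_sq_eq]
  simp only [inner_zero_right, Complex.ofReal_zero, zero_mul, zero_sub]
  rw [neg_div]
  congr 3
  norm_cast
  simp [Fin.sum_univ_two, Matrix.mulVec, dotProduct]
  rw [mul_pow, Real.sq_sqrt hs]
  ring

/-- The density of a pair of standard normal variables with correlation `t`. -/
noncomputable def corrDensity (t : ℝ) (q : ℝ × ℝ) : ℝ :=
  (2 * Real.pi * √(1 - t ^ 2))⁻¹ *
    Real.exp (-(q.1 ^ 2 + q.2 ^ 2 - 2 * t * q.1 * q.2) / (2 * (1 - t ^ 2)))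

theorem corrDensity_nonneg (t : ℝ) (q : ℝ × ℝ) : 0 ≤ corrDensity t q := by
  unfold corrDensity; positivity

theorem measurable_corrDensity (t : ℝ) : Measurable (corrDensity t) := by
  unfold corrDensity; fun_prop

theorem gaussianPDFReal_mul_eq_corrDensity {t : ℝ} (ht : |t| < 1) (x y : ℝ) :
    gaussianPDFReal 0 1 x * gaussianPDFReal (t * x) (Real.toNNReal (1 - t ^ 2)) y =
      corrDensity t (x, y) := by
  have hs : 0 < 1 - t ^ 2 := by
    have := (sq_lt_one_iff_abs_lt_one t).2 ht
    linarith
  have hpi := Real.pi_pos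
  simp only [gaussianPDFReal, corrDensity, NNReal.coe_one, Real.coe_toNNReal _ hs.le]
  rw [mul_mul_mul_comm, ← Real.exp_add, ← mul_inv]
  congr 2
  · rw [mul_one, Real.sqrt_mul (by positivity) (1 - t ^ 2), ← mul_assoc,
      Real.mul_self_sqrt (by positivity)]
  · field_simp
    ring

theorem map_multivariateGaussian_corr {t : ℝ} (ht : |t| < 1) :
    (multivariateGaussian 0 !![1, t; t, 1]).map (fun w => (w 0, w 1)) =
      (volume : Measure (ℝ × ℝ)).withDensity fun q => ENNReal.ofReal (corrDensity t q) := by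
  have hs : 0 < 1 - t ^ 2 := by
    have := (sq_lt_one_iff_abs_lt_one t).2 ht
    linarith
  have hK : Measurable fun q => ENNReal.ofReal (corrDensity t q) :=
    (measurable_corrDensity t).ennreal_ofReal
  refine Measure.ext_of_lintegral _ fun h hh => ?_
  rw [lintegral_map hh (by fun_prop), multivariateGaussian_corr_eq_map ht,
    lintegral_map (by fun_prop) (by fun_prop), ← map_pi_eq_stdGaussian,
    lintegral_map (by fun_prop) (by fun_prop)]
  have h1 := (measurePreserving_finTwoArrow (gaussianReal 0 1)).lintegral_comp
    (f := fun p : ℝ × ℝ => h (p.1, t * p.1 + √(1 - t ^ 2) * p.2)) (by fun_prop)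
  have e1 : ∫⁻ a : Fin 2 → ℝ, h ((!₂[(WithLp.toLp 2 a) 0,
      t * (WithLp.toLp 2 a) 0 + √(1 - t ^ 2) * (WithLp.toLp 2 a) 1] : EuclideanSpace ℝ (Fin 2)) 0,
      (!₂[(WithLp.toLp 2 a) 0,
      t * (WithLp.toLp 2 a) 0 + √(1 - t ^ 2) * (WithLp.toLp 2 a) 1] : EuclideanSpace ℝ (Fin 2)) 1)
      ∂(Measure.pi fun _ => gaussianReal 0 1) =
      ∫⁻ p : ℝ × ℝ, h (p.1, t * p.1 + √(1 - t ^ 2) * p.2)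
        ∂((gaussianReal 0 1).prod (gaussianReal 0 1)) := by
    rw [← h1]
    simp [MeasurableEquiv.finTwoArrow]
  rw [e1, lintegral_prod _ (by fun_prop)]
  have h2 : ∀ x : ℝ, ∫⁻ y, h (x, t * x + √(1 - t ^ 2) * y) ∂(gaussianReal 0 1) =
      ∫⁻ y, gaussianPDF (t * x) (Real.toNNReal (1 - t ^ 2)) y * h (x, y) := by
    intro x
    have hmap : (gaussianReal 0 1).map (fun y => t * x + √(1 - t ^ 2) * y) =
        gaussianReal (t * x) (Real.toNNReal (1 - t ^ 2)) := by
      have : (fun y => t * x + √(1 - t ^ 2) * y) =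
          (fun y => t * x + y) ∘ (fun y => √(1 - t ^ 2) * y) := rfl
      rw [this, ← Measure.map_map (by fun_prop) (by fun_prop), gaussianReal_map_const_mul,
        gaussianReal_map_const_add]
      congr 1
      · simp
      · ext
        simp [Real.sq_sqrt hs.le, hs.le]
    rw [← lintegral_map (f := fun y => h (x, y)) (g := fun y => t * x + √(1 - t ^ 2) * y)
      (by fun_prop) (by fun_prop), hmap,
      gaussianReal_of_var_ne_zero _ (by simpa using hs),
      lintegral_withDensity_eq_lintegral_mul _ (measurable_gaussianPDF _ _) (by fun_prop)]
    rfl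
  have hpdf : Measurable fun z : ℝ × ℝ =>
      gaussianPDF (t * z.1) (Real.toNNReal (1 - t ^ 2)) z.2 * h (z.1, z.2) := by
    refine Measurable.mul ?_ (by fun_prop)
    unfold gaussianPDF gaussianPDFReal
    fun_prop
  have hm : Measurable fun x : ℝ =>
      ∫⁻ y, gaussianPDF (t * x) (Real.toNNReal (1 - t ^ 2)) y * h (x, y) :=
    hpdf.lintegral_prod_right'
  simp_rw [h2]
  rw [gaussianReal_of_var_ne_zero _ one_ne_zero,
    lintegral_withDensity_eq_lintegral_mul₀' (by fun_prop) ,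
    lintegral_withDensity_eq_lintegral_mul _ hK hh, Measure.volume_eq_prod,
    lintegral_prod _ (by fun_prop)]
  · congr with x
    simp only [Pi.mul_apply]
    rw [← lintegral_const_mul']
    · congr with y
      rw [← mul_assoc, gaussianPDF, gaussianPDF, ← ENNReal.ofReal_mul (gaussianPDFReal_nonneg _ _ _),
        gaussianPDFReal_mul_eq_corrDensity ht]
    · simp [gaussianPDF]
  · exact hm.aemeasurable

/-! ### The analytic extension -/

theorem integrable_exp_neg_mul_sq_add_sq {b : ℝ} (hb : 0 < b) :
    Integrable fun q : ℝ × ℝ => Real.exp (-b * (q.1 ^ 2 + q.2 ^ 2)) := by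
  have h := (integrable_exp_neg_mul_sq hb).mul_prod (integrable_exp_neg_mul_sq hb)
  refine h.congr (Eventually.of_forall fun q => ?_)
  simp only [← Real.exp_add]
  ring_nf

/-- The kernel `exp (-P / (4 (1 + z)) - M / (4 (1 - z)))` where `P` and `M` are the squared norms of
the sum and the difference of the two vectors `(x₀, x₁)` and `(y₀, y₁)`, as a function of
`((x₀, y₀), (x₁, y₁))`. -/
noncomputable def corrKernel (z : ℂ) (q : (ℝ × ℝ) × (ℝ × ℝ)) : ℂ :=
  Complex.exp (-(((q.1.1 + q.1.2) ^ 2 + (q.2.1 + q.2.2) ^ 2 : ℝ) : ℂ) * (4 * (1 + z))⁻¹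
    - (((q.1.1 - q.1.2) ^ 2 + (q.2.1 - q.2.2) ^ 2 : ℝ) : ℂ) * (4 * (1 - z))⁻¹)

/-- The candidate for the analytic extension of `t ↦ E[s (X, Y)]`. -/
noncomputable def corrExtension (s : (ℝ × ℝ) × (ℝ × ℝ) → ℝ) (z : ℂ) : ℂ :=
  (4 * (Real.pi : ℂ) ^ 2 * (1 - z ^ 2))⁻¹ * ∫ q, (s q : ℂ) * corrKernel z q

theorem integrable_exp_neg_mul_four {b : ℝ} (hb : 0 < b) :
    Integrable fun q : (ℝ × ℝ) × (ℝ × ℝ) => Real.exp (-b *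
      ((q.1.1 + q.1.2) ^ 2 + (q.2.1 + q.2.2) ^ 2 +
        ((q.1.1 - q.1.2) ^ 2 + (q.2.1 - q.2.2) ^ 2))) := by
  have h := (integrable_exp_neg_mul_sq_add_sq (b := 2 * b) (by positivity)).mul_prod
    (integrable_exp_neg_mul_sq_add_sq (b := 2 * b) (by positivity))
  refine h.congr (Eventually.of_forall fun q => ?_)
  simp only [← Real.exp_add]
  ring_nf

theorem mul_exp_neg_le {b : ℝ} (hb : 0 < b) (x : ℝ) :
    x * Real.exp (-b * x) ≤ 2 / b * Real.exp (-(b / 2) * x) := by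
  have h1 : b / 2 * x ≤ Real.exp (b / 2 * x) := by
    linarith [Real.add_one_le_exp (b / 2 * x)]
  have h2 : Real.exp (-(b / 2) * x) = Real.exp (b / 2 * x) * Real.exp (-b * x) := by
    rw [← Real.exp_add]; ring_nf
  rw [h2, ← mul_assoc]
  gcongr
  calc x = 2 / b * (b / 2 * x) := by field_simp
    _ ≤ _ := by gcongr

theorem one_add_ne_zero_of_mem_strip {z : ℂ} (hz : z ∈ strip) : 1 + z ≠ 0 := by
  intro h
  have h1 := congrArg Complex.re h
  have h2 := abs_lt.1 (show |z.re| < 1 from hz)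
  simp at h1
  linarith

theorem one_sub_ne_zero_of_mem_strip {z : ℂ} (hz : z ∈ strip) : 1 - z ≠ 0 := by
  intro h
  have h1 := congrArg Complex.re h
  have h2 := abs_lt.1 (show |z.re| < 1 from hz)
  simp at h1
  linarith

theorem inv_re_pos_of_re_pos {z : ℂ} (h : 0 < z.re) : 0 < (z⁻¹).re := by
  rw [Complex.inv_re]
  refine div_pos h (Complex.normSq_pos.2 ?_)
  rintro rfl
  simp at h

theorem norm_corrKernel_le {z : ℂ} {ε : ℝ} (h1 : ε ≤ ((4 * (1 + z))⁻¹).re)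
    (h2 : ε ≤ ((4 * (1 - z))⁻¹).re) (q : (ℝ × ℝ) × (ℝ × ℝ)) :
    ‖corrKernel z q‖ ≤ Real.exp (-ε *
      ((q.1.1 + q.1.2) ^ 2 + (q.2.1 + q.2.2) ^ 2 +
        ((q.1.1 - q.1.2) ^ 2 + (q.2.1 - q.2.2) ^ 2))) := by
  rw [corrKernel, Complex.norm_exp, Real.exp_le_exp, Complex.sub_re, neg_mul, Complex.neg_re,
    Complex.re_ofReal_mul, Complex.re_ofReal_mul]
  have hP : 0 ≤ (q.1.1 + q.1.2) ^ 2 + (q.2.1 + q.2.2) ^ 2 := by positivity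
  have hM : 0 ≤ (q.1.1 - q.1.2) ^ 2 + (q.2.1 - q.2.2) ^ 2 := by positivity
  nlinarith [mul_le_mul_of_nonneg_left h1 hP, mul_le_mul_of_nonneg_left h2 hM]

theorem measurable_corrKernel (z : ℂ) : Measurable (corrKernel z) := by
  unfold corrKernel; fun_prop

theorem differentiableAt_integral_corrKernel {s : (ℝ × ℝ) × (ℝ × ℝ) → ℝ} (hs : Measurable s)
    (hb : ∀ q, |s q| ≤ 1) {z₀ : ℂ} (hz : z₀ ∈ strip) :
    DifferentiableAt ℂ (fun z => ∫ q, (s q : ℂ) * corrKernel z q) z₀ := by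
  have hne1 := one_add_ne_zero_of_mem_strip hz
  have hne2 := one_sub_ne_zero_of_mem_strip hz
  have hre := abs_lt.1 (show |z₀.re| < 1 from hz)
  have hα : ContinuousAt (fun z : ℂ => (4 * (1 + z))⁻¹) z₀ :=
    ContinuousAt.inv₀ (by fun_prop) (by simpa using hne1)
  have hβ : ContinuousAt (fun z : ℂ => (4 * (1 - z))⁻¹) z₀ :=
    ContinuousAt.inv₀ (by fun_prop) (by simpa using hne2)
  have pα : 0 < ((4 * (1 + z₀))⁻¹).re := inv_re_pos_of_re_pos (by simp; linarith)
  have pβ : 0 < ((4 * (1 - z₀))⁻¹).re := inv_re_pos_of_re_pos (by simp; linarith)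
  obtain ⟨ε, hε0, hε⟩ := exists_between (lt_min pα pβ)
  obtain ⟨C, hC⟩ := exists_gt (max ‖(4 * (1 + z₀))⁻¹‖ ‖(4 * (1 - z₀))⁻¹‖)
  have hC0 : 0 ≤ C := (norm_nonneg _).trans ((le_max_left _ _).trans hC.le)
  set U : Set ℂ := {z | z ∈ strip ∧ ε < ((4 * (1 + z))⁻¹).re ∧ ε < ((4 * (1 - z))⁻¹).re ∧
    ‖(4 * (1 + z))⁻¹‖ < C ∧ ‖(4 * (1 - z))⁻¹‖ < C} with hU
  have hstrip : strip ∈ 𝓝 z₀ :=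
    (isOpen_lt (by fun_prop) continuous_const : IsOpen {z : ℂ | |z.re| < 1}).mem_nhds hz
  have hUn : U ∈ 𝓝 z₀ := by
    have e1 := (Complex.continuous_re.continuousAt.comp hα).eventually
      (lt_mem_nhds (hε.trans_le (min_le_left _ _)))
    have e2 := (Complex.continuous_re.continuousAt.comp hβ).eventually
      (lt_mem_nhds (hε.trans_le (min_le_right _ _)))
    have e3 := hα.norm.eventually (gt_mem_nhds ((le_max_left _ _).trans_lt hC))
    have e4 := hβ.norm.eventually (gt_mem_nhds ((le_max_right _ _).trans_lt hC))
    filter_upwards [hstrip, e1, e2, e3, e4] with z h0 h1 h2 h3 h4 using ⟨h0, h1, h2, h3, h4⟩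
  have hsn : ∀ q, ‖(s q : ℂ)‖ ≤ 1 := fun q => by simpa using hb q
  have hmeas : ∀ z, AEStronglyMeasurable (fun q => (s q : ℂ) * corrKernel z q) := fun z =>
    ((Complex.measurable_ofReal.comp hs).mul (measurable_corrKernel z)).aestronglyMeasurable
  have key := hasDerivAt_integral_of_dominated_loc_of_deriv_le (𝕜 := ℂ)
    (F := fun z q => (s q : ℂ) * corrKernel z q) (x₀ := z₀) (s := U)
    (μ := (volume : Measure ((ℝ × ℝ) × (ℝ × ℝ))))
    (F' := fun z q => (s q : ℂ) * (corrKernel z q *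
      (((((q.1.1 + q.1.2) ^ 2 + (q.2.1 + q.2.2) ^ 2 : ℝ) : ℂ) * (4 * ((4 * (1 + z))⁻¹) ^ 2)
      - (((q.1.1 - q.1.2) ^ 2 + (q.2.1 - q.2.2) ^ 2 : ℝ) : ℂ) * (4 * ((4 * (1 - z))⁻¹) ^ 2)))))
    (bound := fun q => 4 * C ^ 2 * (2 / ε * Real.exp (-(ε / 2) *
      ((q.1.1 + q.1.2) ^ 2 + (q.2.1 + q.2.2) ^ 2 +
        ((q.1.1 - q.1.2) ^ 2 + (q.2.1 - q.2.2) ^ 2)))))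
    hUn (Eventually.of_forall hmeas) ?_ ?_ (Eventually.of_forall fun q z hzU => ?_) ?_
    (Eventually.of_forall fun q z hzU => ?_)
  · exact key.2.differentiableAt
  · refine (integrable_exp_neg_mul_four hε0).mono' (hmeas z₀) (Eventually.of_forall fun q => ?_)
    rw [norm_mul]
    have := norm_corrKernel_le (hε.le.trans (min_le_left _ _)) (hε.le.trans (min_le_right _ _)) q
    calc _ ≤ 1 * ‖corrKernel z₀ q‖ := by gcongr; exact hsn q
      _ ≤ _ := by simpa using this
  · refine Measurable.aestronglyMeasurable ?_
    refine (Complex.measurable_ofReal.comp hs).mul ((measurable_corrKernel z₀).mul ?_)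
    fun_prop
  · obtain ⟨_, h1, h2, h3, h4⟩ := hzU
    have hP : 0 ≤ (q.1.1 + q.1.2) ^ 2 + (q.2.1 + q.2.2) ^ 2 := by positivity
    have hM : 0 ≤ (q.1.1 - q.1.2) ^ 2 + (q.2.1 - q.2.2) ^ 2 := by positivity
    have hk := norm_corrKernel_le h1.le h2.le q
    have hle := mul_exp_neg_le hε0 ((q.1.1 + q.1.2) ^ 2 + (q.2.1 + q.2.2) ^ 2 +
        ((q.1.1 - q.1.2) ^ 2 + (q.2.1 - q.2.2) ^ 2))
    set P := (q.1.1 + q.1.2) ^ 2 + (q.2.1 + q.2.2) ^ 2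
    set M := (q.1.1 - q.1.2) ^ 2 + (q.2.1 - q.2.2) ^ 2
    have hd : ‖((P : ℂ) * (4 * ((4 * (1 + z))⁻¹) ^ 2) - (M : ℂ) * (4 * ((4 * (1 - z))⁻¹) ^ 2))‖
        ≤ 4 * C ^ 2 * (P + M) := by
      refine (norm_sub_le _ _).trans ?_
      rw [norm_mul, norm_mul, norm_mul, norm_mul, norm_pow, norm_pow, Complex.norm_real,
        Complex.norm_real, Real.norm_of_nonneg hP, Real.norm_of_nonneg hM, Complex.norm_ofNat]
      calc _ ≤ P * (4 * C ^ 2) + M * (4 * C ^ 2) := by gcongr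
        _ = _ := by ring
    rw [norm_mul, norm_mul]
    calc _ ≤ 1 * (Real.exp (-ε * (P + M)) * (4 * C ^ 2 * (P + M))) := by
            gcongr
            exact hsn q
      _ = 4 * C ^ 2 * ((P + M) * Real.exp (-ε * (P + M))) := by ring
      _ ≤ _ := by gcongr
  · exact ((integrable_exp_neg_mul_four (half_pos hε0)).const_mul _).const_mul _
  · have hn1 : (4 * (1 + z)) ≠ 0 := by simpa using one_add_ne_zero_of_mem_strip hzU.1
    have hn2 : (4 * (1 - z)) ≠ 0 := by simpa using one_sub_ne_zero_of_mem_strip hzU.1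
    have d1 : HasDerivAt (fun z : ℂ => (4 * (1 + z))⁻¹) (-(4 * ((4 * (1 + z))⁻¹) ^ 2)) z := by
      refine ((((hasDerivAt_id' z).const_add 1).const_mul 4).fun_inv hn1).congr_deriv ?_
      field_simp
    have d2 : HasDerivAt (fun z : ℂ => (4 * (1 - z))⁻¹) (4 * ((4 * (1 - z))⁻¹) ^ 2) z := by
      refine ((((hasDerivAt_id' z).const_sub 1).const_mul 4).fun_inv hn2).congr_deriv ?_
      field_simp
    exact (((d1.const_mul _).fun_sub (d2.const_mul _)).cexp.congr_deriv
      (by rw [corrKernel]; ring)).const_mul _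

theorem analyticOnNhd_corrExtension {s : (ℝ × ℝ) × (ℝ × ℝ) → ℝ} (hs : Measurable s)
    (hb : ∀ q, |s q| ≤ 1) : AnalyticOnNhd ℂ (corrExtension s) strip := by
  have hopen : IsOpen strip :=
    (isOpen_lt (by fun_prop) continuous_const : IsOpen {z : ℂ | |z.re| < 1})
  refine DifferentiableOn.analyticOnNhd (fun z hz => ?_) hopen
  refine DifferentiableAt.differentiableWithinAt ?_
  have hne : 4 * (Real.pi : ℂ) ^ 2 * (1 - z ^ 2) ≠ 0 := by
    have h1 := one_add_ne_zero_of_mem_strip hz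
    have h2 := one_sub_ne_zero_of_mem_strip hz
    have h3 : (1 - z ^ 2) = (1 + z) * (1 - z) := by ring
    have : (Real.pi : ℂ) ≠ 0 := by exact_mod_cast Real.pi_ne_zero
    rw [h3]
    simp [h1, h2]
  have hd : DifferentiableAt ℂ (fun z : ℂ => 4 * (Real.pi : ℂ) ^ 2 * (1 - z ^ 2)) z := by fun_prop
  exact (hd.inv hne).mul (differentiableAt_integral_corrKernel hs hb hz)

theorem corrDensity_mul_corrDensity {t : ℝ} (ht : |t| < 1) (q : (ℝ × ℝ) × (ℝ × ℝ)) :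
    ((corrDensity t q.1 * corrDensity t q.2 : ℝ) : ℂ) =
      (4 * (Real.pi : ℂ) ^ 2 * (1 - (t : ℂ) ^ 2))⁻¹ * corrKernel t q := by
  have h := abs_lt.1 ht
  have hs : 0 < 1 - t ^ 2 := by nlinarith
  have h1 : 1 + t ≠ 0 := by linarith
  have h2 : 1 - t ≠ 0 := by linarith
  have e : corrKernel t q = ((Real.exp (-((q.1.1 + q.1.2) ^ 2 + (q.2.1 + q.2.2) ^ 2) *
      (4 * (1 + t))⁻¹ - ((q.1.1 - q.1.2) ^ 2 + (q.2.1 - q.2.2) ^ 2) * (4 * (1 - t))⁻¹) : ℝ) : ℂ) := by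
    rw [corrKernel]; push_cast; rfl
  rw [e]
  norm_cast
  rw [corrDensity, corrDensity, mul_mul_mul_comm, ← Real.exp_add, ← mul_inv]
  congr 2
  · rw [mul_mul_mul_comm, Real.mul_self_sqrt hs.le]
    ring
  · have : 1 - t ^ 2 = (1 + t) * (1 - t) := by ring
    rw [this]
    field_simp
    ring

theorem integral_corrGaussianPairs_two {t : ℝ} (ht : |t| < 1)
    {s : (ℝ × ℝ) × (ℝ × ℝ) → ℝ} (hs : Measurable s) :
    ∫ w, s ((w 0 0, w 0 1), (w 1 0, w 1 1)) ∂(corrGaussianPairs 2 t) =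
      ∫ q, s q * (corrDensity t q.1 * corrDensity t q.2) := by
  have hK : Measurable fun q => ENNReal.ofReal (corrDensity t q) :=
    (measurable_corrDensity t).ennreal_ofReal
  set μ := multivariateGaussian (0 : EuclideanSpace ℝ (Fin 2)) !![1, t; t, 1] with hμ
  have h1 := (measurePreserving_finTwoArrow μ).integral_comp'
    (g := fun p => s ((p.1 0, p.1 1), (p.2 0, p.2 1)))
  have h2 : ∫ p, s ((p.1 0, p.1 1), (p.2 0, p.2 1)) ∂(μ.prod μ) =
      ∫ q, s q ∂((μ.map fun w => (w 0, w 1)).prod (μ.map fun w => (w 0, w 1))) := by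
    rw [Measure.map_prod_map _ _ (by fun_prop) (by fun_prop),
      integral_map (by fun_prop) hs.aestronglyMeasurable]
    rfl
  have h3 : ∫ w, s ((w 0 0, w 0 1), (w 1 0, w 1 1)) ∂(corrGaussianPairs 2 t) =
      ∫ p, s ((p.1 0, p.1 1), (p.2 0, p.2 1)) ∂(μ.prod μ) := h1
  have hKK : Measurable fun q : (ℝ × ℝ) × (ℝ × ℝ) =>
      ENNReal.ofReal (corrDensity t q.1) * ENNReal.ofReal (corrDensity t q.2) :=
    (hK.comp measurable_fst).mul (hK.comp measurable_snd)
  rw [h3, h2, hμ, map_multivariateGaussian_corr ht, prod_withDensity hK hK,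
    integral_withDensity_eq_integral_toReal_smul hKK (Eventually.of_forall fun q => by
      simp [ENNReal.mul_lt_top])]
  rw [Measure.volume_eq_prod (ℝ × ℝ) (ℝ × ℝ)]
  congr with q
  rw [ENNReal.toReal_mul, ENNReal.toReal_ofReal (corrDensity_nonneg _ _),
    ENNReal.toReal_ofReal (corrDensity_nonneg _ _), smul_eq_mul, mul_comm]

theorem measurable_real_sign : Measurable Real.sign := by
  unfold Real.sign
  exact Measurable.ite measurableSet_Iio measurable_const
    (Measurable.ite measurableSet_Ioi measurable_const measurable_const)

theorem abs_real_sign_le_one (x : ℝ) : |Real.sign x| ≤ 1 := by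
  rcases Real.sign_apply_eq x with h | h | h <;> simp [h]

theorem isPhi_corrExtension {F G : (Fin 2 → ℝ) → ℝ} (hF : Measurable F) (hG : Measurable G) :
    IsPhi F G (corrExtension fun q =>
      Real.sign (F ![q.1.1, q.2.1]) * Real.sign (G ![q.1.2, q.2.2])) := by
  have hv1 : Measurable fun q : (ℝ × ℝ) × (ℝ × ℝ) => ![q.1.1, q.2.1] := by
    refine measurable_pi_iff.2 fun i => ?_
    fin_cases i <;> simp <;> fun_prop
  have hv2 : Measurable fun q : (ℝ × ℝ) × (ℝ × ℝ) => ![q.1.2, q.2.2] := by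
    refine measurable_pi_iff.2 fun i => ?_
    fin_cases i <;> simp <;> fun_prop
  have hs : Measurable fun q : (ℝ × ℝ) × (ℝ × ℝ) =>
      Real.sign (F ![q.1.1, q.2.1]) * Real.sign (G ![q.1.2, q.2.2]) :=
    (measurable_real_sign.comp (hF.comp hv1)).mul (measurable_real_sign.comp (hG.comp hv2))
  refine ⟨analyticOnNhd_corrExtension hs fun q => ?_, fun t ht => ?_⟩
  · rw [abs_mul]
    exact mul_le_one₀ (abs_real_sign_le_one _) (abs_nonneg _) (abs_real_sign_le_one _)
  · have e : signCorr F G t = ∫ w, Real.sign (F ![w 0 0, w 1 0]) * Real.sign (G ![w 0 1, w 1 1])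
        ∂(corrGaussianPairs 2 t) := by
      unfold signCorr
      congr with w
      congr 3 <;> ext i <;> fin_cases i <;> rfl
    rw [e, integral_corrGaussianPairs_two ht hs, ← integral_complex_ofReal, corrExtension,
      ← integral_const_mul]
    congr with q
    rw [Complex.ofReal_mul (Real.sign _ * Real.sign _), corrDensity_mul_corrDensity ht]
    push_cast
    ring

/-! ### Moments of the complex Gaussian weight -/

/-- The (unnormalised) density of a Gaussian pair with correlation `i`. -/
noncomputable def tiltedGaussian (q : ℝ × ℝ) : ℂ :=
  Complex.exp (((-(q.1 ^ 2 + q.2 ^ 2) / 4 : ℝ) : ℂ) + ((q.1 * q.2 / 2 : ℝ) : ℂ) * Complex.I)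

theorem norm_tiltedGaussian (q : ℝ × ℝ) :
    ‖tiltedGaussian q‖ = Real.exp (-(q.1 ^ 2 + q.2 ^ 2) / 4) := by
  rw [tiltedGaussian, Complex.norm_exp, Complex.add_re, Complex.ofReal_re, Complex.re_ofReal_mul,
    Complex.I_re, mul_zero, add_zero]

theorem continuous_tiltedGaussian : Continuous tiltedGaussian := by
  unfold tiltedGaussian; fun_prop

theorem tiltedGaussian_swap (q : ℝ × ℝ) : tiltedGaussian q.swap = tiltedGaussian q := by
  simp only [tiltedGaussian, Prod.fst_swap, Prod.snd_swap]
  ring_nf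

theorem corrKernel_I (q : (ℝ × ℝ) × (ℝ × ℝ)) :
    corrKernel Complex.I q = tiltedGaussian q.1 * tiltedGaussian q.2 := by
  have h1 : (4 * (1 + Complex.I))⁻¹ = (1 - Complex.I) / 8 := by
    refine inv_eq_of_mul_eq_one_right ?_
    linear_combination (-1 / 2 : ℂ) * Complex.I_sq
  have h2 : (4 * (1 - Complex.I))⁻¹ = (1 + Complex.I) / 8 := by
    refine inv_eq_of_mul_eq_one_right ?_
    linear_combination (-1 / 2 : ℂ) * Complex.I_sq
  rw [corrKernel, tiltedGaussian, tiltedGaussian, ← Complex.exp_add, h1, h2]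
  congr 1
  push_cast
  ring

theorem one_add_pow_mul_exp_le (n : ℕ) {s : ℝ} (hs : 0 ≤ s) :
    (1 + s) ^ n * Real.exp (-s / 4) ≤
      8 ^ n * n.factorial * Real.exp (1 / 8) * Real.exp (-(1 / 8) * s) := by
  have h := Real.pow_div_factorial_le_exp ((1 + s) / 8) (by positivity) n
  have h2 : (1 + s) ^ n ≤ 8 ^ n * n.factorial * Real.exp ((1 + s) / 8) := by
    rw [div_pow, div_div, div_le_iff₀ (by positivity)] at h
    linarith
  calc (1 + s) ^ n * Real.exp (-s / 4) ≤
        (8 ^ n * n.factorial * Real.exp ((1 + s) / 8)) * Real.exp (-s / 4) := by gcongr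
    _ = 8 ^ n * n.factorial * (Real.exp ((1 + s) / 8) * Real.exp (-s / 4)) := by ring
    _ = 8 ^ n * n.factorial * (Real.exp (1 / 8) * Real.exp (-(1 / 8) * s)) := by
      rw [← Real.exp_add, ← Real.exp_add]
      ring_nf
    _ = _ := by ring

theorem integrable_pow_mul_exp_neg (n : ℕ) :
    Integrable fun q : ℝ × ℝ =>
      (1 + (q.1 ^ 2 + q.2 ^ 2)) ^ n * Real.exp (-(q.1 ^ 2 + q.2 ^ 2) / 4) := by
  refine ((integrable_exp_neg_mul_sq_add_sq (b := 1 / 8) (by norm_num)).const_mul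
    (8 ^ n * n.factorial * Real.exp (1 / 8))).mono' (by fun_prop)
    (Eventually.of_forall fun q => ?_)
  rw [Real.norm_of_nonneg (by positivity)]
  exact one_add_pow_mul_exp_le n (by positivity)

/-- A function of polynomial growth is integrable against the weight. -/
theorem integrable_mul_tiltedGaussian {f : ℝ × ℝ → ℂ} (hf : AEStronglyMeasurable f) (n : ℕ) (C : ℝ)
    (hb : ∀ q, ‖f q‖ ≤ C * (1 + (q.1 ^ 2 + q.2 ^ 2)) ^ n) :
    Integrable fun q => f q * tiltedGaussian q := by
  refine ((integrable_pow_mul_exp_neg n).const_mul C).mono'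
    (hf.mul continuous_tiltedGaussian.aestronglyMeasurable) (Eventually.of_forall fun q => ?_)
  rw [norm_mul, norm_tiltedGaussian, ← mul_assoc]
  gcongr
  exact hb q

theorem integrable_tiltedGaussian : Integrable tiltedGaussian := by
  have := integrable_mul_tiltedGaussian (f := fun _ => 1) aestronglyMeasurable_const 0 1
    (by simp)
  simpa using this

theorem abs_le_one_add_sq_add_sq (x y : ℝ) : |x| ≤ 1 + (x ^ 2 + y ^ 2) :=
  abs_le.2 ⟨by nlinarith [sq_nonneg (x + 1), sq_nonneg y],
    by nlinarith [sq_nonneg (x - 1), sq_nonneg y]⟩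

theorem integrable_monomial_mul_tiltedGaussian (j k : ℕ) :
    Integrable fun q : ℝ × ℝ => (q.1 : ℂ) ^ j * (q.2 : ℂ) ^ k * tiltedGaussian q := by
  refine integrable_mul_tiltedGaussian (f := fun q : ℝ × ℝ => (q.1 : ℂ) ^ j * (q.2 : ℂ) ^ k)
    (Continuous.aestronglyMeasurable (by fun_prop)) (j + k) 1 fun q => ?_
  rw [norm_mul, norm_pow, norm_pow, Complex.norm_real, Complex.norm_real, one_mul, pow_add,
    Real.norm_eq_abs, Real.norm_eq_abs]
  gcongr
  · exact abs_le_one_add_sq_add_sq _ _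
  · rw [add_comm (q.1 ^ 2)]
    exact abs_le_one_add_sq_add_sq _ _

theorem integrable_tiltedGaussian_right (x : ℝ) (k : ℕ) :
    Integrable fun y : ℝ => (y : ℂ) ^ k * tiltedGaussian (x, y) := by
  have h := integrable_rpow_mul_exp_neg_mul_sq (b := 1 / 4) (by norm_num) (s := k)
    (by linarith [(Nat.cast_nonneg k : (0 : ℝ) ≤ k)])
  refine (h.norm.const_mul (Real.exp (-x ^ 2 / 4))).mono'
    (Continuous.aestronglyMeasurable ?_) (Eventually.of_forall fun y => ?_)
  · exact (by fun_prop : Continuous fun y : ℝ => (y : ℂ) ^ k).mul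
      (continuous_tiltedGaussian.comp (by fun_prop))
  · rw [norm_mul, norm_mul, norm_tiltedGaussian, Real.rpow_natCast, norm_pow, norm_pow,
      Complex.norm_real, Real.norm_of_nonneg (Real.exp_pos _).le]
    have : Real.exp (-((x, y).1 ^ 2 + (x, y).2 ^ 2) / 4) =
        Real.exp (-x ^ 2 / 4) * Real.exp (-(1 / 4) * y ^ 2) := by
      rw [← Real.exp_add]; ring_nf
    rw [this]
    exact le_of_eq (by ring)

/-- The mixed moments of the unnormalised complex weight. -/
noncomputable def tiltedMoment (j k : ℕ) : ℂ :=
  ∫ q : ℝ × ℝ, (q.1 : ℂ) ^ j * (q.2 : ℂ) ^ k * tiltedGaussian q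

theorem tiltedMoment_comm (j k : ℕ) : tiltedMoment j k = tiltedMoment k j := by
  unfold tiltedMoment
  rw [Measure.volume_eq_prod, ← integral_prod_swap]
  congr with q
  rw [tiltedGaussian_swap, Prod.fst_swap, Prod.snd_swap]
  ring

/-- Integration by parts in the second variable. -/
theorem tiltedMoment_succ (j k : ℕ) :
    tiltedMoment j (k + 1) =
      Complex.I * tiltedMoment (j + 1) k + 2 * k * tiltedMoment j (k - 1) := by
  have hd : ∀ x y : ℝ, HasDerivAt (fun y : ℝ => (y : ℂ) ^ k * tiltedGaussian (x, y))
      (k * ((y : ℂ) ^ (k - 1) * tiltedGaussian (x, y))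
        + (Complex.I * x / 2 * ((y : ℂ) ^ k * tiltedGaussian (x, y))
        - 1 / 2 * ((y : ℂ) ^ (k + 1) * tiltedGaussian (x, y)))) y := by
    intro x y
    have h1 : HasDerivAt (fun y : ℂ => y ^ k * Complex.exp (-(x ^ 2 + y ^ 2) / 4 +
        x * y / 2 * Complex.I)) (k * (y : ℂ) ^ (k - 1) *
          Complex.exp (-(x ^ 2 + (y : ℂ) ^ 2) / 4 + x * y / 2 * Complex.I) + (y : ℂ) ^ k *
          (Complex.exp (-(x ^ 2 + (y : ℂ) ^ 2) / 4 + x * y / 2 * Complex.I) *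
          (-(2 * y) / 4 + x / 2 * Complex.I))) (y : ℂ) := by
      refine (hasDerivAt_pow k (y : ℂ)).fun_mul (HasDerivAt.cexp ?_)
      have h2 := ((((hasDerivAt_pow 2 (y : ℂ)).const_add ((x : ℂ) ^ 2)).fun_neg).div_const 4).fun_add
        ((((hasDerivAt_id' (y : ℂ)).const_mul (x : ℂ)).div_const 2).mul_const Complex.I)
      refine h2.congr_deriv ?_
      simp
    have h3 := h1.comp_ofReal
    have e : ∀ y : ℝ, tiltedGaussian (x, y) =
        Complex.exp (-(x ^ 2 + (y : ℂ) ^ 2) / 4 + x * y / 2 * Complex.I) := fun y => by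
      rw [tiltedGaussian]; push_cast; rfl
    simp only [e]
    refine h3.congr_deriv ?_
    ring
  have hzero : ∀ x : ℝ, ∫ y : ℝ, (k * ((y : ℂ) ^ (k - 1) * tiltedGaussian (x, y))
        + (Complex.I * x / 2 * ((y : ℂ) ^ k * tiltedGaussian (x, y))
        - 1 / 2 * ((y : ℂ) ^ (k + 1) * tiltedGaussian (x, y)))) = 0 := fun x =>
    integral_eq_zero_of_hasDerivAt_of_integrable (hd x)
      (((integrable_tiltedGaussian_right x _).const_mul _).add
        (((integrable_tiltedGaussian_right x _).const_mul _).sub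
          ((integrable_tiltedGaussian_right x _).const_mul _)))
      (integrable_tiltedGaussian_right x k)
  have i1 := (integrable_monomial_mul_tiltedGaussian j (k - 1)).const_mul (k : ℂ)
  have i2 := (integrable_monomial_mul_tiltedGaussian (j + 1) k).const_mul (Complex.I / 2)
  have i3 := (integrable_monomial_mul_tiltedGaussian j (k + 1)).const_mul (1 / 2 : ℂ)
  have i23 : Integrable fun q : ℝ × ℝ =>
      Complex.I / 2 * ((q.1 : ℂ) ^ (j + 1) * (q.2 : ℂ) ^ k * tiltedGaussian q) -
        1 / 2 * ((q.1 : ℂ) ^ j * (q.2 : ℂ) ^ (k + 1) * tiltedGaussian q) := i2.sub i3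
  have htot : ∫ q : ℝ × ℝ, (k * ((q.1 : ℂ) ^ j * (q.2 : ℂ) ^ (k - 1) * tiltedGaussian q) +
      (Complex.I / 2 * ((q.1 : ℂ) ^ (j + 1) * (q.2 : ℂ) ^ k * tiltedGaussian q) -
        1 / 2 * ((q.1 : ℂ) ^ j * (q.2 : ℂ) ^ (k + 1) * tiltedGaussian q))) = 0 := by
    rw [Measure.volume_eq_prod, integral_prod _ (i1.fun_add i23)]
    refine integral_eq_zero_of_ae (Eventually.of_forall fun x => ?_)
    have := hzero x
    calc _ = ∫ y : ℝ, (x : ℂ) ^ j * (k * ((y : ℂ) ^ (k - 1) * tiltedGaussian (x, y))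
        + (Complex.I * x / 2 * ((y : ℂ) ^ k * tiltedGaussian (x, y))
        - 1 / 2 * ((y : ℂ) ^ (k + 1) * tiltedGaussian (x, y)))) := by
          refine integral_congr_ae (Eventually.of_forall fun y => ?_)
          dsimp only
          ring
      _ = 0 := by rw [integral_const_mul, this, mul_zero]
  rw [integral_add i1 i23, integral_sub i2 i3, integral_const_mul, integral_const_mul,
    integral_const_mul] at htot
  unfold tiltedMoment
  linear_combination -2 * htot

theorem tiltedMoment_one_zero : tiltedMoment 1 0 = 0 := by
  have h1 := tiltedMoment_succ 0 0
  rw [tiltedMoment_comm 0 1] at h1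
  simp at h1
  have : (1 - Complex.I) * tiltedMoment 1 0 = 0 := by linear_combination h1
  rcases mul_eq_zero.1 this with h | h
  · have := congrArg Complex.re h
    simp at this
  · exact h

theorem tiltedMoment_add_two_zero (j : ℕ) :
    tiltedMoment (j + 2) 0 = (j + 1) * tiltedMoment j 0 := by
  have h1 := tiltedMoment_succ 0 (j + 1)
  have h2 := tiltedMoment_succ (j + 1) 0
  rw [tiltedMoment_comm 0, tiltedMoment_comm (0 + 1), tiltedMoment_comm 0] at h1
  simp at h1 h2
  rw [h2] at h1
  linear_combination (1 / 2 : ℂ) * h1 + (1 / 2 : ℂ) * tiltedMoment (j + 2) 0 * Complex.I_sq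

/-- The moments of a standard normal variable. -/
def gaussianMoment : ℕ → ℤ
  | 0 => 1
  | 1 => 0
  | n + 2 => (n + 1) * gaussianMoment n

/-- The mixed moments of a Gaussian pair with correlation `i`, up to a power of `i`. -/
def mixedMoment (j : ℕ) : ℕ → ℤ
  | 0 => gaussianMoment j
  | k + 1 => mixedMoment (j + 1) k - 2 * k * mixedMoment j (k - 1)
termination_by k => k
decreasing_by all_goals omega

theorem mixedMoment_zero (j : ℕ) : mixedMoment j 0 = gaussianMoment j := by
  rw [mixedMoment]

theorem mixedMoment_succ (j k : ℕ) : mixedMoment j (k + 1) =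
    mixedMoment (j + 1) k - 2 * k * mixedMoment j (k - 1) := by
  rw [mixedMoment]

theorem tiltedMoment_zero_right (j : ℕ) :
    tiltedMoment j 0 = tiltedMoment 0 0 * gaussianMoment j := by
  induction j using Nat.strong_induction_on with
  | _ j ih =>
    match j with
    | 0 => simp [gaussianMoment]
    | 1 => simp [gaussianMoment, tiltedMoment_one_zero]
    | n + 2 =>
      rw [tiltedMoment_add_two_zero, ih n (by omega), gaussianMoment]
      push_cast
      ring

theorem tiltedMoment_eq (j k : ℕ) :
    tiltedMoment j k = tiltedMoment 0 0 * (Complex.I ^ k * mixedMoment j k) := by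
  induction k using Nat.strong_induction_on generalizing j with
  | _ k ih =>
    match k with
    | 0 => simp [mixedMoment_zero, tiltedMoment_zero_right j]
    | 1 =>
      rw [tiltedMoment_succ, ih 0 (by omega), mixedMoment_succ j 0]
      simp
      ring
    | n + 2 =>
      rw [tiltedMoment_succ, ih (n + 1) (by omega), mixedMoment_succ j (n + 1),
        ih (n + 1 - 1) (by omega) j]
      simp only [Nat.add_sub_cancel]
      push_cast
      linear_combination (2 * (n + 1) * tiltedMoment 0 0 * mixedMoment j n * Complex.I ^ n) *
        Complex.I_sq

theorem tiltedMoment_zero_zero : tiltedMoment 0 0 = ((2 * √2 * Real.pi : ℝ) : ℂ) := by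
  have hx : ∀ x : ℝ, ∫ y : ℝ, tiltedGaussian (x, y) =
      ((2 * √Real.pi * Real.exp (-(1 / 2) * x ^ 2) : ℝ) : ℂ) := by
    intro x
    have h := fourierIntegral_gaussian (b := 1 / 4) (by norm_num) ((x / 2 : ℝ) : ℂ)
    have e : ∀ y : ℝ, tiltedGaussian (x, y) = Complex.exp (-(x : ℂ) ^ 2 / 4) *
        (Complex.exp (Complex.I * ((x / 2 : ℝ) : ℂ) * y) * Complex.exp (-(1 / 4) * (y : ℂ) ^ 2)) := by
      intro y
      rw [tiltedGaussian, ← Complex.exp_add, ← Complex.exp_add]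
      push_cast
      ring_nf
    simp_rw [e]
    rw [integral_const_mul, h]
    have hs : ((Real.pi : ℂ) / (1 / 4)) ^ (1 / 2 : ℂ) = ((2 * √Real.pi : ℝ) : ℂ) := by
      have : ((Real.pi : ℂ) / (1 / 4)) = ((4 * Real.pi : ℝ) : ℂ) := by push_cast; ring
      rw [this, show (1 / 2 : ℂ) = ((1 / 2 : ℝ) : ℂ) by push_cast; rfl,
        ← Complex.ofReal_cpow (by positivity), ← Real.sqrt_eq_rpow,
        Real.sqrt_mul (by norm_num), show (4 : ℝ) = 2 ^ 2 by norm_num,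
        Real.sqrt_sq (by norm_num)]
    rw [hs, mul_left_comm, ← Complex.exp_add]
    push_cast
    ring_nf
  have h0 : tiltedMoment 0 0 = ∫ q : ℝ × ℝ, tiltedGaussian q := by simp [tiltedMoment]
  rw [h0, Measure.volume_eq_prod, integral_prod _ integrable_tiltedGaussian]
  simp_rw [hx]
  rw [integral_complex_ofReal, integral_const_mul, integral_gaussian]
  congr 1
  rw [show Real.pi / (1 / 2) = 2 * Real.pi by ring, Real.sqrt_mul (by norm_num)]
  linear_combination (2 * √2) * Real.mul_self_sqrt Real.pi_pos.le

/-- `f` is integrable against the weight, with normalised integral `c`. -/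
def HasTiltedMean (f : ℝ × ℝ → ℂ) (c : ℂ) : Prop :=
  Integrable (fun q => f q * tiltedGaussian q) ∧
    ∫ q, f q * tiltedGaussian q = tiltedMoment 0 0 * c

namespace HasTiltedMean

theorem monomial (j k : ℕ) :
    HasTiltedMean (fun q => (q.1 : ℂ) ^ j * (q.2 : ℂ) ^ k) (Complex.I ^ k * mixedMoment j k) :=
  ⟨integrable_monomial_mul_tiltedGaussian j k, tiltedMoment_eq j k⟩

theorem add {f g : ℝ × ℝ → ℂ} {c d : ℂ} (hf : HasTiltedMean f c) (hg : HasTiltedMean g d) :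
    HasTiltedMean (fun q => f q + g q) (c + d) := by
  refine ⟨?_, ?_⟩
  · simpa only [add_mul] using hf.1.fun_add hg.1
  · simp only [add_mul]
    rw [integral_add hf.1 hg.1, hf.2, hg.2, mul_add]

theorem const_mul {f : ℝ × ℝ → ℂ} {c : ℂ} (a : ℂ) (hf : HasTiltedMean f c) :
    HasTiltedMean (fun q => a * f q) (a * c) := by
  refine ⟨?_, ?_⟩
  · simpa only [mul_assoc] using hf.1.const_mul a
  · simp only [mul_assoc]
    rw [integral_const_mul, hf.2, mul_left_comm]

theorem swap {f : ℝ × ℝ → ℂ} {c : ℂ} (hf : HasTiltedMean f c) :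
    HasTiltedMean (fun q => f q.swap) c := by
  have e : (fun q : ℝ × ℝ => f q.swap * tiltedGaussian q) =
      fun q => (fun p => f p * tiltedGaussian p) q.swap := by
    ext q
    simp [tiltedGaussian_swap]
  refine ⟨?_, ?_⟩
  · rw [e]
    exact Integrable.swap hf.1
  · rw [e]
    exact (integral_prod_swap fun p => f p * tiltedGaussian p).trans hf.2

theorem congr {f g : ℝ × ℝ → ℂ} {c d : ℂ} (hf : HasTiltedMean f c) (h : ∀ q, f q = g q)
    (hc : c = d) : HasTiltedMean g d := by
  obtain rfl := funext h
  exact hc ▸ hf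

end HasTiltedMean

/-- The third Hermite polynomial. -/
def hermiteThree (x : ℝ) : ℝ := x ^ 3 - 3 * x

/-- The quartic form in the expansion of `E[sign (X - a) * sign (Y - b)]`. -/
noncomputable def signQuartic (a b : ℂ) : ℂ :=
  -2 * Complex.I * (a ^ 2 + b ^ 2) + 4 * a * b + 5 * Complex.I / 12 * (a ^ 4 + b ^ 4)
    - (a ^ 3 * b + a * b ^ 3) / 3 + Complex.I / 2 * a ^ 2 * b ^ 2

theorem hasTiltedMean_signQuartic (η : ℝ) :
    HasTiltedMean (fun q => signQuartic ((η * hermiteThree q.1 : ℝ) : ℂ)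
      ((-(η * hermiteThree q.2) : ℝ) : ℂ)) (864 * Complex.I * η ^ 4) := by
  have m := HasTiltedMean.monomial
  have sq : HasTiltedMean (fun q => (hermiteThree q.1 : ℂ) ^ 2) 6 := by
    refine (((m 6 0).add ((m 4 0).const_mul (-6))).add ((m 2 0).const_mul 9)).congr (fun q => ?_) ?_
    · simp only [hermiteThree]; push_cast; ring
    · simp [mixedMoment, gaussianMoment]; norm_num
  have four : HasTiltedMean (fun q => (hermiteThree q.1 : ℂ) ^ 4) 3348 := by
    refine (((((m 12 0).add ((m 10 0).const_mul (-12))).add ((m 8 0).const_mul 54)).add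
      ((m 6 0).const_mul (-108))).add ((m 4 0).const_mul 81)).congr (fun q => ?_) ?_
    · simp only [hermiteThree]; push_cast; ring
    · simp [mixedMoment, gaussianMoment]; norm_num
  have mixed : HasTiltedMean (fun q => (hermiteThree q.1 : ℂ) * hermiteThree q.2)
      (-6 * Complex.I) := by
    refine ((((m 3 3).add ((m 3 1).const_mul (-3))).add ((m 1 3).const_mul (-3))).add
      ((m 1 1).const_mul 9)).congr (fun q => ?_) ?_
    · simp only [hermiteThree]; push_cast; ring
    · simp [mixedMoment, gaussianMoment, Complex.I_pow_three]; ring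
  have cube : HasTiltedMean (fun q => (hermiteThree q.1 : ℂ) ^ 3 * hermiteThree q.2)
      (-3348 * Complex.I) := by
    refine (((((m 9 3).add ((m 7 3).const_mul (-9))).add ((m 5 3).const_mul 27)).add
      ((m 3 3).const_mul (-27))).add (((((m 9 1).add ((m 7 1).const_mul (-9))).add
      ((m 5 1).const_mul 27)).add ((m 3 1).const_mul (-27))).const_mul (-3))).congr (fun q => ?_) ?_
    · simp only [hermiteThree]; push_cast; ring
    · simp [mixedMoment, gaussianMoment, Complex.I_pow_three]; ring
  have sqsq : HasTiltedMean (fun q => (hermiteThree q.1 : ℂ) ^ 2 * (hermiteThree q.2 : ℂ) ^ 2)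
      612 := by
    refine (((((m 6 6).add ((m 4 6).const_mul (-6))).add ((m 2 6).const_mul 9)).add
      ((((m 6 4).add ((m 4 4).const_mul (-6))).add ((m 2 4).const_mul 9)).const_mul (-6))).add
      ((((m 6 2).add ((m 4 2).const_mul (-6))).add ((m 2 2).const_mul 9)).const_mul 9)).congr
      (fun q => ?_) ?_
    · simp only [hermiteThree]; push_cast; ring
    · have h6 : Complex.I ^ 6 = -1 := by
        rw [show 6 = 4 + 2 from rfl, pow_add, Complex.I_pow_four, Complex.I_sq, one_mul]
      simp [mixedMoment, gaussianMoment, h6, Complex.I_pow_four]; norm_num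
  refine ((((((sq.add sq.swap).const_mul (-2 * Complex.I * η ^ 2)).add
    (mixed.const_mul (-4 * (η : ℂ) ^ 2))).add
    ((four.add four.swap).const_mul (5 * Complex.I / 12 * η ^ 4))).add
    ((cube.add cube.swap).const_mul ((η : ℂ) ^ 4 / 3))).add
    (sqsq.const_mul (Complex.I / 2 * η ^ 4))).congr (fun q => ?_) ?_
  · simp only [signQuartic, Prod.fst_swap, Prod.snd_swap]; push_cast; ring
  · ring

/-! ### Expansion of the sign correlation in the thresholds -/

/-- The signed indicator of the interval between `0` and `a`. -/
noncomputable def signedIndicator (a x : ℝ) : ℝ :=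
  (Set.Ioc 0 a).indicator 1 x - (Set.Ioc a 0).indicator 1 x

theorem measurable_signedIndicator (a : ℝ) : Measurable (signedIndicator a) :=
  (measurable_one.indicator measurableSet_Ioc).sub (measurable_one.indicator measurableSet_Ioc)

theorem abs_signedIndicator_le_one (a x : ℝ) : |signedIndicator a x| ≤ 1 := by
  unfold signedIndicator
  by_cases h1 : x ∈ Set.Ioc 0 a <;> by_cases h2 : x ∈ Set.Ioc a 0 <;> simp [h1, h2]

theorem integral_signedIndicator_mul (a : ℝ) {f : ℝ → ℂ}
    (hf : LocallyIntegrable f) :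
    ∫ x, (signedIndicator a x : ℂ) * f x = ∫ x in (0 : ℝ)..a, f x := by
  have e : ∀ x, (signedIndicator a x : ℂ) * f x =
      (Set.Ioc 0 a).indicator f x - (Set.Ioc a 0).indicator f x := by
    intro x
    unfold signedIndicator
    by_cases h1 : x ∈ Set.Ioc 0 a <;> by_cases h2 : x ∈ Set.Ioc a 0 <;> simp [h1, h2]
  have hint : ∀ c d : ℝ, Integrable ((Set.Ioc c d).indicator f) := fun c d =>
    ((hf.integrableOn_isCompact isCompact_Icc).mono_set
      Set.Ioc_subset_Icc_self).integrable_indicator measurableSet_Ioc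
  simp_rw [e]
  rw [integral_sub (hint _ _) (hint _ _), integral_indicator measurableSet_Ioc,
    integral_indicator measurableSet_Ioc]
  rfl

theorem sign_sub_eq_sign_sub_signedIndicator {a x : ℝ} (h0 : x ≠ 0) (ha : x ≠ a) :
    Real.sign (x - a) = Real.sign x - 2 * signedIndicator a x := by
  unfold signedIndicator
  rcases lt_or_gt_of_ne h0 with h0 | h0 <;> rcases lt_or_gt_of_ne ha with ha | ha
  · rw [Real.sign_of_neg h0, Real.sign_of_neg (by linarith),
      Set.indicator_of_notMem (by simp; intros; linarith),
      Set.indicator_of_notMem (by simp; intros; linarith)]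
    simp
  · rw [Real.sign_of_neg h0, Real.sign_of_pos (by linarith),
      Set.indicator_of_notMem (by simp; intros; linarith),
      Set.indicator_of_mem (by constructor <;> linarith)]
    norm_num
  · rw [Real.sign_of_pos h0, Real.sign_of_neg (by linarith),
      Set.indicator_of_mem (by constructor <;> linarith),
      Set.indicator_of_notMem (by simp; intros; linarith)]
    norm_num
  · rw [Real.sign_of_pos h0, Real.sign_of_pos (by linarith),
      Set.indicator_of_notMem (by simp; intros; linarith),
      Set.indicator_of_notMem (by simp; intros; linarith)]
    simp

theorem integrable_bdd_mul_tiltedGaussian {f : ℝ × ℝ → ℝ} (hf : Measurable f)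
    (hb : ∀ q, |f q| ≤ 1) : Integrable fun q => (f q : ℂ) * tiltedGaussian q :=
  integrable_mul_tiltedGaussian (Complex.measurable_ofReal.comp hf).aestronglyMeasurable 0 1
    (by simpa using hb)

/-- `E[sign (X - a) * sign (Y - b)]` against the unnormalised complex weight. -/
noncomputable def signMean (a b : ℝ) : ℂ :=
  ∫ q : ℝ × ℝ, ((Real.sign (q.1 - a) * Real.sign (q.2 - b) : ℝ) : ℂ) * tiltedGaussian q

/-- The integral of `sign y` against the weight, as a function of `x`. -/
noncomputable def signMarginal (x : ℝ) : ℂ :=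
  ∫ y : ℝ, (Real.sign y : ℂ) * tiltedGaussian (x, y)

theorem integrable_bdd_mul_tiltedGaussian_right {f : ℝ → ℝ} (hf : Measurable f)
    (hb : ∀ y, |f y| ≤ 1) (x : ℝ) : Integrable fun y => (f y : ℂ) * tiltedGaussian (x, y) := by
  have h := integrable_tiltedGaussian_right x 0
  simp only [pow_zero, one_mul] at h
  refine h.bdd_mul (c := 1) (Complex.measurable_ofReal.comp hf).aestronglyMeasurable
    (Eventually.of_forall fun y => ?_)
  simpa using hb y

theorem continuous_integral_bdd_mul_tiltedGaussian {f : ℝ → ℝ} (hf : Measurable f)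
    (hb : ∀ y, |f y| ≤ 1) : Continuous fun x => ∫ y : ℝ, (f y : ℂ) * tiltedGaussian (x, y) := by
  refine continuous_of_dominated (bound := fun y => Real.exp (-(1 / 4) * y ^ 2))
    (fun x => (integrable_bdd_mul_tiltedGaussian_right hf hb x).aestronglyMeasurable)
    (fun x => Eventually.of_forall fun y => ?_) (integrable_exp_neg_mul_sq (by norm_num))
    (Eventually.of_forall fun y => ?_)
  · rw [norm_mul, norm_tiltedGaussian, Complex.norm_real, Real.norm_eq_abs]
    calc _ ≤ 1 * Real.exp (-(x ^ 2 + y ^ 2) / 4) := by gcongr; exact hb y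
      _ ≤ _ := by
        rw [one_mul, Real.exp_le_exp]
        nlinarith [sq_nonneg x]
  · exact continuous_const.mul (continuous_tiltedGaussian.comp (by fun_prop))

theorem integral_signedIndicator_mul_prod (a : ℝ) {f : ℝ → ℝ} (hf : Measurable f)
    (hb : ∀ y, |f y| ≤ 1) :
    ∫ q : ℝ × ℝ, ((signedIndicator a q.1 * f q.2 : ℝ) : ℂ) * tiltedGaussian q =
      ∫ x in (0 : ℝ)..a, ∫ y : ℝ, (f y : ℂ) * tiltedGaussian (x, y) := by
  rw [← integral_signedIndicator_mul a
    (continuous_integral_bdd_mul_tiltedGaussian hf hb).locallyIntegrable,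
    Measure.volume_eq_prod, integral_prod]
  · congr with x
    rw [← integral_const_mul]
    congr with y
    push_cast
    ring
  · refine integrable_bdd_mul_tiltedGaussian (((measurable_signedIndicator a).comp
      measurable_fst).mul (hf.comp measurable_snd)) fun q => ?_
    rw [abs_mul]
    exact mul_le_one₀ (abs_signedIndicator_le_one _ _) (abs_nonneg _) (hb _)

theorem signMean_eq (a b : ℝ) :
    signMean a b = signMean 0 0 - 2 * (∫ x in (0 : ℝ)..a, signMarginal x)
      - 2 * (∫ x in (0 : ℝ)..b, signMarginal x)
      + 4 * ∫ x in (0 : ℝ)..a, ∫ y in (0 : ℝ)..b, tiltedGaussian (x, y) := by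
  have hae : ∀ a : ℝ, ∀ᵐ x : ℝ, Real.sign (x - a) = Real.sign x - 2 * signedIndicator a x := by
    intro a
    filter_upwards [Measure.ae_ne volume 0, Measure.ae_ne volume a] with x h1 h2
    exact sign_sub_eq_sign_sub_signedIndicator h1 h2
  have hbd : ∀ {f g : ℝ → ℝ}, Measurable f → Measurable g → (∀ x, |f x| ≤ 1) → (∀ x, |g x| ≤ 1) →
      Integrable fun q : ℝ × ℝ => ((f q.1 * g q.2 : ℝ) : ℂ) * tiltedGaussian q := by
    intro f g hf hg hf1 hg1
    refine integrable_bdd_mul_tiltedGaussian ((hf.comp measurable_fst).mul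
      (hg.comp measurable_snd)) fun q => ?_
    rw [abs_mul]
    exact mul_le_one₀ (hf1 _) (abs_nonneg _) (hg1 _)
  have ms := measurable_real_sign
  have bs := abs_real_sign_le_one
  have mi := measurable_signedIndicator
  have bi := abs_signedIndicator_le_one
  have i1 := hbd ms ms bs bs
  have i2 := (hbd (mi a) ms (bi a) bs).const_mul 2
  have i3 := (hbd ms (mi b) bs (bi b)).const_mul 2
  have i4 := (hbd (mi a) (mi b) (bi a) (bi b)).const_mul 4
  have e : signMean a b = ∫ q : ℝ × ℝ,
      ((((Real.sign q.1 * Real.sign q.2 : ℝ) : ℂ) * tiltedGaussian q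
        - 2 * (((signedIndicator a q.1 * Real.sign q.2 : ℝ) : ℂ) * tiltedGaussian q))
        - 2 * (((Real.sign q.1 * signedIndicator b q.2 : ℝ) : ℂ) * tiltedGaussian q))
        + 4 * (((signedIndicator a q.1 * signedIndicator b q.2 : ℝ) : ℂ) * tiltedGaussian q) := by
    refine integral_congr_ae ?_
    filter_upwards [Measure.quasiMeasurePreserving_fst.ae (hae a),
      Measure.quasiMeasurePreserving_snd.ae (hae b)] with q h1 h2
    rw [h1, h2]
    push_cast
    ring
  have i12 : Integrable fun q : ℝ × ℝ => ((Real.sign q.1 * Real.sign q.2 : ℝ) : ℂ) *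
      tiltedGaussian q - 2 * (((signedIndicator a q.1 * Real.sign q.2 : ℝ) : ℂ) *
        tiltedGaussian q) := i1.sub i2
  have i123 : Integrable fun q : ℝ × ℝ => ((Real.sign q.1 * Real.sign q.2 : ℝ) : ℂ) *
      tiltedGaussian q - 2 * (((signedIndicator a q.1 * Real.sign q.2 : ℝ) : ℂ) *
        tiltedGaussian q) - 2 * (((Real.sign q.1 * signedIndicator b q.2 : ℝ) : ℂ) *
        tiltedGaussian q) := i12.sub i3
  rw [e, integral_add i123 i4, integral_sub i12 i3, integral_sub i1 i2, integral_const_mul,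
    integral_const_mul, integral_const_mul, integral_signedIndicator_mul_prod a ms bs,
    integral_signedIndicator_mul_prod a (mi b) (bi b)]
  have hswap : ∫ q : ℝ × ℝ, ((Real.sign q.1 * signedIndicator b q.2 : ℝ) : ℂ) * tiltedGaussian q =
      ∫ x in (0 : ℝ)..b, signMarginal x := by
    have h := integral_signedIndicator_mul_prod b ms bs
    simp only [signMarginal]
    rw [← h, Measure.volume_eq_prod, ← integral_prod_swap]
    congr with q
    rw [tiltedGaussian_swap, Prod.fst_swap, Prod.snd_swap, mul_comm (Real.sign q.2)]
  rw [hswap]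
  have hin : ∀ x : ℝ, ∫ y : ℝ, (signedIndicator b y : ℂ) * tiltedGaussian (x, y) =
      ∫ y in (0 : ℝ)..b, tiltedGaussian (x, y) := fun x =>
    integral_signedIndicator_mul b
      (continuous_tiltedGaussian.comp (by fun_prop : Continuous fun y => (x, y))).locallyIntegrable
  simp_rw [hin]
  simp [signMean, signMarginal]

theorem abs_sin_sub_self_le (u : ℝ) : |Real.sin u - u| ≤ 2 * u ^ 2 := by
  rcases le_or_gt |u| 1 with h | h
  · have h1 := Real.sin_bound h
    have h2 : |Real.sin u - u| ≤ |Real.sin u - (u - u ^ 3 / 6)| + |u ^ 3 / 6| := by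
      have := abs_sub_le (Real.sin u) (u - u ^ 3 / 6) u
      have e : u - u ^ 3 / 6 - u = -(u ^ 3 / 6) := by ring
      rwa [e, abs_neg] at this
    rw [abs_div, abs_pow, abs_of_pos (by norm_num : (0 : ℝ) < 6)] at h2
    have h0 := abs_nonneg u
    have : |u| ^ 3 ≤ |u| ^ 2 := pow_le_pow_of_le_one h0 h (by norm_num)
    have : |u| ^ 4 ≤ |u| ^ 2 := pow_le_pow_of_le_one h0 h (by norm_num)
    rw [← sq_abs u]
    nlinarith [sq_nonneg |u|]
  · have h1 := Real.abs_sin_le_one u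
    have := abs_sub (Real.sin u) u
    rw [← sq_abs u]
    nlinarith

theorem abs_sin_sub_cubic_le (u : ℝ) : |Real.sin u - (u - u ^ 3 / 6)| ≤ 3 * u ^ 4 := by
  have e4 : u ^ 4 = |u| ^ 4 := by rw [← abs_pow, abs_of_nonneg (by positivity)]
  rcases le_or_gt |u| 1 with h | h
  · have h1 := Real.sin_bound h
    have : 0 ≤ |u| ^ 4 := by positivity
    have : |u| ^ 5 ≤ |u| ^ 4 := pow_le_pow_of_le_one (abs_nonneg u) h (by norm_num)
    rw [e4]
    linarith
  · have h1 := Real.abs_sin_le_one u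
    have h2 := abs_sub (Real.sin u) (u - u ^ 3 / 6)
    have h3 := abs_sub u (u ^ 3 / 6)
    rw [abs_div, abs_pow, abs_of_pos (by norm_num : (0 : ℝ) < 6)] at h3
    have : 1 ≤ |u| ^ 4 := one_le_pow₀ h.le
    have : |u| ^ 1 ≤ |u| ^ 4 := pow_le_pow_right₀ h.le (by norm_num)
    have : |u| ^ 3 ≤ |u| ^ 4 := pow_le_pow_right₀ h.le (by norm_num)
    rw [e4]
    simp only [pow_one] at *
    linarith

theorem norm_cexp_sub_one_sub_self_le {w : ℂ} (hw : w.re ≤ 0) :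
    ‖Complex.exp w - 1 - w‖ ≤ 3 * ‖w‖ ^ 2 := by
  rcases le_or_gt ‖w‖ 1 with h | h
  · have := Complex.norm_exp_sub_one_sub_id_le h
    nlinarith [sq_nonneg ‖w‖]
  · have h1 : ‖Complex.exp w‖ ≤ 1 := by
      rw [Complex.norm_exp]
      exact Real.exp_le_one_iff.2 hw
    have h2 := norm_sub_le (Complex.exp w - 1) w
    have h3 := norm_sub_le (Complex.exp w) 1
    rw [norm_one] at h3
    nlinarith

theorem abs_exp_neg_mul_sin_sub_le (x y : ℝ) :
    |Real.exp (-x ^ 2 / 4) * Real.sin (x * y / 2) - (x * y / 2 - x ^ 3 * y ^ 3 / 48 - x ^ 3 * y / 8)|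
      ≤ x ^ 4 * (1 + y ^ 2) ^ 2 := by
  have h1 : |Real.exp (-x ^ 2 / 4) - 1 + x ^ 2 / 4| ≤ 3 * (x ^ 2 / 4) ^ 2 := by
    have := norm_cexp_sub_one_sub_self_le (w := ((-x ^ 2 / 4 : ℝ) : ℂ))
      (by rw [Complex.ofReal_re]; nlinarith [sq_nonneg x])
    rw [← Complex.ofReal_exp, ← Complex.ofReal_one, ← Complex.ofReal_sub, ← Complex.ofReal_sub,
      Complex.norm_real, Complex.norm_real, Real.norm_eq_abs, Real.norm_eq_abs, sq_abs] at this
    calc _ = |Real.exp (-x ^ 2 / 4) - 1 - -x ^ 2 / 4| := by ring_nf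
      _ ≤ _ := this
      _ = _ := by ring
  have h2 := abs_sin_sub_cubic_le (x * y / 2)
  have h3 := abs_sin_sub_self_le (x * y / 2)
  have h4 := Real.abs_sin_le_one (x * y / 2)
  set e := Real.exp (-x ^ 2 / 4)
  set s := Real.sin (x * y / 2)
  have key : e * s - (x * y / 2 - x ^ 3 * y ^ 3 / 48 - x ^ 3 * y / 8) =
      (e - 1 + x ^ 2 / 4) * s + (s - (x * y / 2 - (x * y / 2) ^ 3 / 6))
        - x ^ 2 / 4 * (s - x * y / 2) := by ring
  rw [key]
  refine (abs_sub _ _).trans ((add_le_add_left (abs_add_le _ _) _).trans ?_)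
  rw [abs_mul, abs_mul, abs_of_nonneg (by positivity : 0 ≤ x ^ 2 / 4)]
  calc _ ≤ 3 * (x ^ 2 / 4) ^ 2 * 1 + 3 * (x * y / 2) ^ 4 + x ^ 2 / 4 * (2 * (x * y / 2) ^ 2) := by
        gcongr
    _ = x ^ 4 * (3 / 16 + 3 / 16 * y ^ 4 + y ^ 2 / 8) := by ring
    _ ≤ _ := by
      gcongr
      nlinarith [sq_nonneg y, sq_nonneg (y ^ 2)]

theorem integral_sign_mul_pow_mul_exp (k : ℕ) :
    ∫ y : ℝ, Real.sign y * y ^ (2 * k + 1) * Real.exp (-y ^ 2 / 4) = 4 ^ (k + 1) * k.factorial := by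
  have e : ∀ y : ℝ, Real.sign y * y ^ (2 * k + 1) * Real.exp (-y ^ 2 / 4) =
      (fun r => r ^ (2 * k + 1) * Real.exp (-r ^ 2 / 4)) |y| := by
    intro y
    simp only [sq_abs]
    congr 1
    rw [pow_succ, pow_succ, pow_mul, pow_mul, sq_abs, mul_left_comm]
    congr 1
    rcases lt_trichotomy y 0 with h | rfl | h
    · rw [Real.sign_of_neg h, abs_of_neg h]; ring
    · simp
    · rw [Real.sign_of_pos h, abs_of_pos h]; ring
  rw [integral_congr_ae (Eventually.of_forall e),
    integral_comp_abs (f := fun r => r ^ (2 * k + 1) * Real.exp (-r ^ 2 / 4))]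
  have h := integral_rpow_mul_exp_neg_mul_rpow (p := 2) (q := (2 * k + 1 : ℕ)) (b := 1 / 4)
    (by norm_num) (by linarith [(Nat.cast_nonneg (2 * k + 1) : (0 : ℝ) ≤ (2 * k + 1 : ℕ))])
    (by norm_num)
  have e2 : ((2 * k + 1 : ℕ) + 1 : ℝ) / 2 = (k + 1 : ℕ) := by push_cast; ring
  rw [e2, neg_div, e2, Real.rpow_neg (by norm_num), Real.rpow_natCast] at h
  have e3 : ∫ r in Set.Ioi (0 : ℝ), r ^ (2 * k + 1) * Real.exp (-r ^ 2 / 4) =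
      ∫ x in Set.Ioi (0 : ℝ), x ^ ((2 * k + 1 : ℕ) : ℝ) * Real.exp (-(1 / 4) * x ^ (2 : ℝ)) := by
    congr with x
    rw [Real.rpow_natCast, show (2 : ℝ) = ((2 : ℕ) : ℝ) by norm_num, Real.rpow_natCast]
    congr 2
    ring
  rw [e3, h]
  push_cast
  rw [Real.Gamma_nat_eq_factorial, one_div, inv_pow, inv_inv]
  ring

theorem integrable_poly_mul_exp_neg (n : ℕ) :
    Integrable fun y : ℝ => (1 + y ^ 2) ^ n * Real.exp (-y ^ 2 / 4) := by
  refine ((integrable_exp_neg_mul_sq (b := 1 / 8) (by norm_num)).const_mul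
    (8 ^ n * n.factorial * Real.exp (1 / 8))).mono' (by fun_prop)
    (Eventually.of_forall fun y => ?_)
  rw [Real.norm_of_nonneg (by positivity)]
  exact one_add_pow_mul_exp_le n (by positivity)

theorem signMarginal_eq (x : ℝ) : signMarginal x = Complex.I * ((∫ y : ℝ, Real.sign y *
    (Real.exp (-x ^ 2 / 4) * Real.sin (x * y / 2)) * Real.exp (-y ^ 2 / 4) : ℝ) : ℂ) := by
  have hi := integrable_bdd_mul_tiltedGaussian_right measurable_real_sign abs_real_sign_le_one x
  have h1 : signMarginal x = ∫ y : ℝ, -((Real.sign y : ℂ) * tiltedGaussian (x, -y)) := by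
    rw [signMarginal, ← integral_neg_eq_self]
    congr with y
    rw [Real.sign_neg]
    push_cast
    ring
  have hi2 : Integrable fun y : ℝ => -((Real.sign y : ℂ) * tiltedGaussian (x, -y)) := by
    refine hi.comp_neg.congr (Eventually.of_forall fun y => ?_)
    simp only [Real.sign_neg]
    push_cast
    ring
  have h2 : 2 * signMarginal x = ∫ y : ℝ, ((Real.sign y : ℂ) * tiltedGaussian (x, y) +
      -((Real.sign y : ℂ) * tiltedGaussian (x, -y))) := by
    rw [integral_add hi hi2, ← h1, two_mul, signMarginal]
  have h3 : ∀ y : ℝ, (Real.sign y : ℂ) * tiltedGaussian (x, y) +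
      -((Real.sign y : ℂ) * tiltedGaussian (x, -y)) = 2 * Complex.I * ((Real.sign y *
        (Real.exp (-x ^ 2 / 4) * Real.sin (x * y / 2)) * Real.exp (-y ^ 2 / 4) : ℝ) : ℂ) := by
    intro y
    simp only [tiltedGaussian]
    have e1 : ((-(x ^ 2 + (-y) ^ 2) / 4 : ℝ) : ℂ) = ((-(x ^ 2 + y ^ 2) / 4 : ℝ) : ℂ) := by
      push_cast; ring
    have e2 : ((x * (-y) / 2 : ℝ) : ℂ) = -((x * y / 2 : ℝ) : ℂ) := by push_cast; ring
    have e3 : Real.exp (-(x ^ 2 + y ^ 2) / 4) = Real.exp (-x ^ 2 / 4) * Real.exp (-y ^ 2 / 4) := by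
      rw [← Real.exp_add]; ring_nf
    rw [e1, e2, Complex.exp_add, Complex.exp_add, Complex.exp_mul_I, Complex.exp_mul_I,
      Complex.cos_neg, Complex.sin_neg, ← Complex.ofReal_exp, e3, ← Complex.ofReal_sin]
    push_cast
    ring
  simp_rw [h3] at h2
  rw [integral_const_mul, integral_complex_ofReal] at h2
  linear_combination (1 / 2 : ℂ) * h2

theorem exists_norm_signMarginal_sub_le : ∃ C : ℝ, 0 ≤ C ∧ ∀ x : ℝ,
    ‖signMarginal x - Complex.I * ((2 * x - 5 / 6 * x ^ 3 : ℝ) : ℂ)‖ ≤ C * x ^ 4 := by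
  refine ⟨∫ y : ℝ, (1 + y ^ 2) ^ 2 * Real.exp (-y ^ 2 / 4),
    integral_nonneg fun y => by positivity, fun x => ?_⟩
  have i0 : Integrable fun y : ℝ => Real.sign y *
      (Real.exp (-x ^ 2 / 4) * Real.sin (x * y / 2)) * Real.exp (-y ^ 2 / 4) := by
    refine (integrable_poly_mul_exp_neg 0).mono' ?_ (Eventually.of_forall fun y => ?_)
    · exact ((measurable_real_sign.mul (by fun_prop)).mul (by fun_prop)).aestronglyMeasurable
    · rw [norm_mul, norm_mul, norm_mul, Real.norm_of_nonneg (Real.exp_pos _).le,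
        Real.norm_of_nonneg (Real.exp_pos _).le, pow_zero]
      gcongr
      refine mul_le_one₀ (abs_real_sign_le_one y) (by positivity)
        (mul_le_one₀ (Real.exp_le_one_iff.2 (by nlinarith [sq_nonneg x])) (norm_nonneg _)
          (Real.abs_sin_le_one _))
  have iodd : ∀ k : ℕ, Integrable fun y : ℝ =>
      Real.sign y * y ^ (2 * k + 1) * Real.exp (-y ^ 2 / 4) := by
    intro k
    refine (integrable_poly_mul_exp_neg (2 * k + 1)).mono' ?_ (Eventually.of_forall fun y => ?_)
    · exact ((measurable_real_sign.mul (by fun_prop)).mul (by fun_prop)).aestronglyMeasurable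
    · rw [norm_mul, norm_mul, Real.norm_of_nonneg (Real.exp_pos _).le, norm_pow]
      gcongr
      calc _ ≤ 1 * (1 + y ^ 2) ^ (2 * k + 1) := by
            gcongr
            · exact abs_real_sign_le_one y
            · have := abs_le_one_add_sq_add_sq y 0
              simpa using this
        _ = _ := one_mul _
  have i1 := (iodd 0).const_mul (x / 2 - x ^ 3 / 8)
  have i3 := (iodd 1).const_mul (x ^ 3 / 48)
  have i13 : Integrable fun y : ℝ =>
      (x / 2 - x ^ 3 / 8) * (Real.sign y * y ^ (2 * 0 + 1) * Real.exp (-y ^ 2 / 4))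
      - x ^ 3 / 48 * (Real.sign y * y ^ (2 * 1 + 1) * Real.exp (-y ^ 2 / 4)) := i1.sub i3
  have hpoly : ∫ y : ℝ, ((x / 2 - x ^ 3 / 8) * (Real.sign y * y ^ (2 * 0 + 1) * Real.exp (-y ^ 2 / 4))
      - x ^ 3 / 48 * (Real.sign y * y ^ (2 * 1 + 1) * Real.exp (-y ^ 2 / 4))) =
      2 * x - 5 / 6 * x ^ 3 := by
    rw [integral_sub i1 i3, integral_const_mul, integral_const_mul, integral_sign_mul_pow_mul_exp,
      integral_sign_mul_pow_mul_exp]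
    norm_num
    ring
  rw [signMarginal_eq, ← mul_sub, norm_mul, Complex.norm_I, one_mul, ← Complex.ofReal_sub,
    Complex.norm_real, ← hpoly, ← integral_sub i0 i13, ← integral_mul_const]
  refine norm_integral_le_of_norm_le ((integrable_poly_mul_exp_neg 2).mul_const _)
    (Eventually.of_forall fun y => ?_)
  have e : Real.sign y * (Real.exp (-x ^ 2 / 4) * Real.sin (x * y / 2)) * Real.exp (-y ^ 2 / 4) -
      ((x / 2 - x ^ 3 / 8) * (Real.sign y * y ^ (2 * 0 + 1) * Real.exp (-y ^ 2 / 4))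
      - x ^ 3 / 48 * (Real.sign y * y ^ (2 * 1 + 1) * Real.exp (-y ^ 2 / 4))) =
      Real.sign y * (Real.exp (-x ^ 2 / 4) * Real.sin (x * y / 2) -
        (x * y / 2 - x ^ 3 * y ^ 3 / 48 - x ^ 3 * y / 8)) * Real.exp (-y ^ 2 / 4) := by ring
  rw [e, norm_mul, norm_mul, Real.norm_of_nonneg (Real.exp_pos _).le]
  calc _ ≤ 1 * (x ^ 4 * (1 + y ^ 2) ^ 2) * Real.exp (-y ^ 2 / 4) := by
        gcongr
        · exact abs_real_sign_le_one y
        · exact abs_exp_neg_mul_sin_sub_le x y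
    _ = _ := by ring

theorem continuous_signMarginal : Continuous signMarginal :=
  continuous_integral_bdd_mul_tiltedGaussian measurable_real_sign abs_real_sign_le_one

theorem abs_le_abs_of_mem_uIoc_zero {a x : ℝ} (hx : x ∈ Set.uIoc 0 a) : |x| ≤ |a| := by
  rcases Set.mem_uIoc.1 hx with h | h
  · rw [abs_of_pos h.1, abs_of_pos (h.1.trans_le h.2)]; exact h.2
  · rw [abs_of_nonpos h.2, abs_of_neg (h.1.trans_le h.2)]; linarith [h.1]

theorem exists_norm_integral_signMarginal_sub_le : ∃ C : ℝ, 0 ≤ C ∧ ∀ a : ℝ,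
    ‖(∫ x in (0 : ℝ)..a, signMarginal x) - Complex.I * (a ^ 2 - 5 / 24 * a ^ 4)‖ ≤
      C * |a| ^ 5 := by
  obtain ⟨C, hC, h⟩ := exists_norm_signMarginal_sub_le
  refine ⟨C, hC, fun a => ?_⟩
  have e : ∫ x in (0 : ℝ)..a, Complex.I * ((2 * x - 5 / 6 * x ^ 3 : ℝ) : ℂ) =
      Complex.I * (a ^ 2 - 5 / 24 * a ^ 4) := by
    rw [intervalIntegral.integral_const_mul, intervalIntegral.integral_ofReal,
      intervalIntegral.integral_sub (Continuous.intervalIntegrable (by fun_prop) _ _)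
        (Continuous.intervalIntegrable (by fun_prop) _ _),
      intervalIntegral.integral_const_mul, intervalIntegral.integral_const_mul, integral_id,
      integral_pow]
    push_cast
    ring
  rw [← e, ← intervalIntegral.integral_sub (continuous_signMarginal.intervalIntegrable _ _)
    (Continuous.intervalIntegrable (by fun_prop) _ _)]
  have hb := intervalIntegral.norm_integral_le_of_norm_le_const (a := 0) (b := a) (C := C * |a| ^ 4)
    (f := fun x => signMarginal x - Complex.I * ((2 * x - 5 / 6 * x ^ 3 : ℝ) : ℂ)) (fun x hx => ?_)
  · calc _ ≤ _ := hb
      _ = _ := by rw [sub_zero]; ring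
  · refine (h x).trans ?_
    have := abs_le_abs_of_mem_uIoc_zero hx
    rw [← Even.pow_abs (by decide : Even 4) x]
    gcongr

theorem norm_tiltedGaussian_sub_le (x y : ℝ) :
    ‖tiltedGaussian (x, y) - (1 - ((x : ℂ) ^ 2 + (y : ℂ) ^ 2) / 4 + x * y / 2 * Complex.I)‖ ≤
      (x ^ 2 + y ^ 2) ^ 2 := by
  set w : ℂ := ((-(x ^ 2 + y ^ 2) / 4 : ℝ) : ℂ) + ((x * y / 2 : ℝ) : ℂ) * Complex.I with hw
  have hre : w.re ≤ 0 := by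
    rw [hw, Complex.add_re, Complex.ofReal_re, Complex.re_ofReal_mul, Complex.I_re, mul_zero,
      add_zero]
    nlinarith [sq_nonneg x, sq_nonneg y]
  have h := norm_cexp_sub_one_sub_self_le hre
  have hn : ‖w‖ ≤ (x ^ 2 + y ^ 2) / 2 := by
    refine (norm_add_le _ _).trans ?_
    rw [norm_mul, Complex.norm_I, Complex.norm_real, Complex.norm_real, Real.norm_eq_abs,
      Real.norm_eq_abs, abs_of_nonpos (by nlinarith [sq_nonneg x, sq_nonneg y]), mul_one]
    have : |x * y / 2| ≤ (x ^ 2 + y ^ 2) / 4 :=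
      abs_le.2 ⟨by nlinarith [sq_nonneg (x + y)], by nlinarith [sq_nonneg (x - y)]⟩
    linarith
  calc _ = ‖Complex.exp w - 1 - w‖ := by
        rw [tiltedGaussian, hw]
        congr 1
        push_cast
        ring
    _ ≤ 3 * ‖w‖ ^ 2 := h
    _ ≤ 3 * ((x ^ 2 + y ^ 2) / 2) ^ 2 := by gcongr
    _ ≤ _ := by nlinarith [sq_nonneg (x ^ 2 + y ^ 2)]

theorem norm_integral_tiltedGaussian_sub_le (a b : ℝ) :
    ‖(∫ x in (0 : ℝ)..a, ∫ y in (0 : ℝ)..b, tiltedGaussian (x, y)) -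
      (a * b - (a ^ 3 * b + a * b ^ 3) / 12 + a ^ 2 * b ^ 2 / 8 * Complex.I)‖ ≤
      (a ^ 2 + b ^ 2) ^ 2 * |a| * |b| := by
  have hin : ∀ x : ℝ, ∫ y in (0 : ℝ)..b,
      (1 - ((x : ℂ) ^ 2 + (y : ℂ) ^ 2) / 4 + x * y / 2 * Complex.I) =
      b - (x ^ 2 * b + b ^ 3 / 3) / 4 + x * b ^ 2 / 4 * Complex.I := by
    intro x
    have hd : ∀ y : ℝ, HasDerivAt (fun y : ℝ => (y : ℂ) - ((x : ℂ) ^ 2 * y + (y : ℂ) ^ 3 / 3) / 4 +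
        x * (y : ℂ) ^ 2 / 4 * Complex.I)
        (1 - ((x : ℂ) ^ 2 + (y : ℂ) ^ 2) / 4 + x * y / 2 * Complex.I) y := by
      intro y
      have : HasDerivAt (fun y : ℂ => y - ((x : ℂ) ^ 2 * y + y ^ 3 / 3) / 4 +
        x * y ^ 2 / 4 * Complex.I)
        (1 - ((x : ℂ) ^ 2 + (y : ℂ) ^ 2) / 4 + x * y / 2 * Complex.I) (y : ℂ) := by
        refine ((((hasDerivAt_id' (y : ℂ)).fun_sub ((((hasDerivAt_id' (y : ℂ)).const_mul
          ((x : ℂ) ^ 2)).fun_add ((hasDerivAt_pow 3 (y : ℂ)).div_const 3)).div_const 4)).fun_add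
          ((((hasDerivAt_pow 2 (y : ℂ)).const_mul (x : ℂ)).div_const 4).mul_const
            Complex.I))).congr_deriv ?_
        push_cast
        ring
      exact this.comp_ofReal
    rw [intervalIntegral.integral_eq_sub_of_hasDerivAt (fun y _ => hd y)
      (Continuous.intervalIntegrable (by fun_prop) _ _)]
    push_cast
    ring
  have hout : ∫ x in (0 : ℝ)..a, ((b : ℂ) - ((x : ℂ) ^ 2 * b + (b : ℂ) ^ 3 / 3) / 4 +
      x * (b : ℂ) ^ 2 / 4 * Complex.I) =
      a * b - (a ^ 3 * b + a * b ^ 3) / 12 + a ^ 2 * b ^ 2 / 8 * Complex.I := by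
    have hd : ∀ x : ℝ, HasDerivAt (fun x : ℝ => (x : ℂ) * b - ((x : ℂ) ^ 3 * b + x * b ^ 3) / 12 +
        (x : ℂ) ^ 2 * b ^ 2 / 8 * Complex.I) ((b : ℂ) - ((x : ℂ) ^ 2 * b + (b : ℂ) ^ 3 / 3) / 4 +
      x * (b : ℂ) ^ 2 / 4 * Complex.I) x := by
      intro x
      have : HasDerivAt (fun x : ℂ => x * b - (x ^ 3 * b + x * b ^ 3) / 12 +
        x ^ 2 * b ^ 2 / 8 * Complex.I) ((b : ℂ) - ((x : ℂ) ^ 2 * b + (b : ℂ) ^ 3 / 3) / 4 +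
          x * (b : ℂ) ^ 2 / 4 * Complex.I) (x : ℂ) := by
        refine ((((hasDerivAt_id' (x : ℂ)).mul_const (b : ℂ)).fun_sub
          ((((hasDerivAt_pow 3 (x : ℂ)).mul_const (b : ℂ)).fun_add
          ((hasDerivAt_id' (x : ℂ)).mul_const ((b : ℂ) ^ 3))).div_const 12)).fun_add
          ((((hasDerivAt_pow 2 (x : ℂ)).mul_const ((b : ℂ) ^ 2)).div_const 8).mul_const
            Complex.I)).congr_deriv ?_
        push_cast
        ring
      exact this.comp_ofReal
    rw [intervalIntegral.integral_eq_sub_of_hasDerivAt (fun y _ => hd y)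
      (Continuous.intervalIntegrable (by fun_prop) _ _)]
    push_cast
    ring
  have hc : ∀ x : ℝ, Continuous fun y => tiltedGaussian (x, y) := fun x =>
    continuous_tiltedGaussian.comp (by fun_prop)
  have hc2 : Continuous fun x => ∫ y in (0 : ℝ)..b, tiltedGaussian (x, y) :=
    intervalIntegral.continuous_parametric_intervalIntegral_of_continuous'
      (f := fun x y => tiltedGaussian (x, y)) continuous_tiltedGaussian 0 b
  rw [← hout]
  simp_rw [← hin]
  rw [← intervalIntegral.integral_sub (hc2.intervalIntegrable _ _)
    (Continuous.intervalIntegrable (by simp_rw [hin]; fun_prop) _ _)]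
  refine (intervalIntegral.norm_integral_le_of_norm_le_const
    (C := (a ^ 2 + b ^ 2) ^ 2 * |b|) fun x hx => ?_).trans (le_of_eq (by rw [sub_zero]; ring))
  rw [← intervalIntegral.integral_sub ((hc x).intervalIntegrable _ _)
    (Continuous.intervalIntegrable (by fun_prop) _ _)]
  refine (intervalIntegral.norm_integral_le_of_norm_le_const
    (C := (a ^ 2 + b ^ 2) ^ 2) fun y hy => ?_).trans (le_of_eq (by rw [sub_zero]))
  refine (norm_tiltedGaussian_sub_le x y).trans ?_
  have h1 := sq_le_sq.2 (abs_le_abs_of_mem_uIoc_zero hx)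
  have h2 := sq_le_sq.2 (abs_le_abs_of_mem_uIoc_zero hy)
  gcongr

theorem exists_norm_signMean_sub_le : ∃ C : ℝ, 0 ≤ C ∧ ∀ a b : ℝ,
    ‖signMean a b - signMean 0 0 - signQuartic a b‖ ≤
      C * (|a| ^ 5 + |b| ^ 5 + (a ^ 2 + b ^ 2) ^ 2 * |a| * |b|) := by
  obtain ⟨C, hC, h⟩ := exists_norm_integral_signMarginal_sub_le
  refine ⟨2 * C + 4, by positivity, fun a b => ?_⟩
  have h1 := h a
  have h2 := h b
  have h3 := norm_integral_tiltedGaussian_sub_le a b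
  have key : signMean a b - signMean 0 0 - signQuartic a b =
      (-2) * ((∫ x in (0 : ℝ)..a, signMarginal x) - Complex.I * (a ^ 2 - 5 / 24 * a ^ 4)) +
      (-2) * ((∫ x in (0 : ℝ)..b, signMarginal x) - Complex.I * (b ^ 2 - 5 / 24 * b ^ 4)) +
      4 * ((∫ x in (0 : ℝ)..a, ∫ y in (0 : ℝ)..b, tiltedGaussian (x, y)) -
      (a * b - (a ^ 3 * b + a * b ^ 3) / 12 + a ^ 2 * b ^ 2 / 8 * Complex.I)) := by
    rw [signMean_eq, signQuartic]
    ring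
  rw [key]
  refine (norm_add₃_le ..).trans ?_
  rw [norm_mul, norm_mul, norm_mul, norm_neg, Complex.norm_ofNat, Complex.norm_ofNat]
  have p1 : 0 ≤ |a| ^ 5 := by positivity
  have p2 : 0 ≤ |b| ^ 5 := by positivity
  have p3 : 0 ≤ (a ^ 2 + b ^ 2) ^ 2 * |a| * |b| := by positivity
  nlinarith [mul_nonneg hC p3]

/-! ### The value at `i` for two half-spaces -/

theorem integral_ray (s : ℝ) :
    ∫ x in Set.Ioi (0 : ℝ), x * (Real.sin (x ^ 2 * s / 2) * Real.exp (-(x ^ 2 * (1 + s ^ 2)) / 4)) =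
      4 * s / (s ^ 4 + 6 * s ^ 2 + 1) := by
  set b : ℂ := ((1 + s ^ 2) / 4 : ℝ) - ((s / 2 : ℝ) : ℂ) * Complex.I with hb
  have hre : b.re = (1 + s ^ 2) / 4 := by
    rw [hb, Complex.sub_re, Complex.ofReal_re, Complex.re_ofReal_mul, Complex.I_re, mul_zero,
      sub_zero]
  have him : b.im = -(s / 2) := by
    rw [hb, Complex.sub_im, Complex.ofReal_im, Complex.im_ofReal_mul, Complex.I_im, mul_one,
      zero_sub]
  have hpos : 0 < b.re := by rw [hre]; positivity
  have h := integral_mul_cexp_neg_mul_sq hpos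
  have hint : IntegrableOn (fun r : ℝ => (r : ℂ) * Complex.exp (-b * (r : ℂ) ^ 2)) (Set.Ioi 0) :=
    (integrable_mul_cexp_neg_mul_sq hpos).integrableOn
  have e : ∀ x : ℝ, x * (Real.sin (x ^ 2 * s / 2) * Real.exp (-(x ^ 2 * (1 + s ^ 2)) / 4)) =
      ((x : ℂ) * Complex.exp (-b * (x : ℂ) ^ 2)).im := by
    intro x
    have : -b * (x : ℂ) ^ 2 = ((-(x ^ 2 * (1 + s ^ 2)) / 4 : ℝ) : ℂ) +
        ((x ^ 2 * s / 2 : ℝ) : ℂ) * Complex.I := by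
      rw [hb]; push_cast; ring
    rw [Complex.im_ofReal_mul, this, Complex.exp_add, ← Complex.ofReal_exp, Complex.im_ofReal_mul,
      Complex.exp_ofReal_mul_I_im]
    ring
  simp_rw [e]
  have h2 : ∫ x in Set.Ioi (0 : ℝ), ((x : ℂ) * Complex.exp (-b * (x : ℂ) ^ 2)).im = ((2 * b)⁻¹).im := by
    rw [← h]
    exact integral_im hint
  rw [h2, Complex.inv_im, Complex.normSq_apply]
  simp only [Complex.mul_re, Complex.mul_im, Complex.re_ofNat, Complex.im_ofNat, hre, him]
  have hd : s ^ 4 + 6 * s ^ 2 + 1 ≠ 0 := by positivity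
  rw [div_eq_div_iff _ hd]
  · ring
  · have : (0 : ℝ) < (1 + s ^ 2) ^ 2 := by positivity
    nlinarith [sq_nonneg s]

theorem integral_rational :
    ∫ s in Set.Ioi (0 : ℝ), 4 * s / (s ^ 4 + 6 * s ^ 2 + 1) = √2 * Real.log (1 + √2) := by
  have h2 : √2 ^ 2 = 2 := Real.sq_sqrt (by norm_num)
  have h2p : 0 < √2 := by positivity
  have hlt : √2 < 3 / 2 := by nlinarith
  have hgt : 1 < √2 := by nlinarith
  have hp : ∀ s : ℝ, 0 < s ^ 2 + (3 - 2 * √2) := fun s => by nlinarith [sq_nonneg s]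
  have hq : ∀ s : ℝ, 0 < s ^ 2 + (3 + 2 * √2) := fun s => by nlinarith [sq_nonneg s]
  set f : ℝ → ℝ := fun s => √2 / 4 * Real.log ((s ^ 2 + (3 - 2 * √2)) / (s ^ 2 + (3 + 2 * √2)))
    with hf
  have hd : ∀ s : ℝ, HasDerivAt f (4 * s / (s ^ 4 + 6 * s ^ 2 + 1)) s := by
    intro s
    have hd1 : HasDerivAt (fun s : ℝ => s ^ 2 + (3 - 2 * √2)) (2 * s) s := by
      simpa using (hasDerivAt_pow 2 s).add_const (3 - 2 * √2)
    have hd2 : HasDerivAt (fun s : ℝ => s ^ 2 + (3 + 2 * √2)) (2 * s) s := by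
      simpa using (hasDerivAt_pow 2 s).add_const (3 + 2 * √2)
    refine (((hd1.fun_div hd2 (hq s).ne').log (div_pos (hp s) (hq s)).ne').const_mul
      (√2 / 4)).congr_deriv ?_
    have e : s ^ 4 + 6 * s ^ 2 + 1 = (s ^ 2 + (3 - 2 * √2)) * (s ^ 2 + (3 + 2 * √2)) := by
      linear_combination 4 * h2
    have key : ∀ A B : ℝ, A ≠ 0 → B ≠ 0 → B = A + 4 * √2 →
        √2 / 4 * ((2 * s * B - A * (2 * s)) / B ^ 2 / (A / B)) = 4 * s / (A * B) := by
      rintro A B hA hB h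
      have : 2 * s * B - A * (2 * s) = 8 * √2 * s := by rw [h]; ring
      rw [this]
      field_simp
      linear_combination 8 * s * h2
    rw [e]
    exact key _ _ (hp s).ne' (hq s).ne' (by ring)
  have hlim : Tendsto f atTop (𝓝 0) := by
    have h1 : Tendsto (fun s : ℝ => s ^ 2 + (3 + 2 * √2)) atTop atTop :=
      tendsto_atTop_add_const_right _ _ (tendsto_pow_atTop two_ne_zero)
    have h3 : Tendsto (fun s : ℝ => 1 - 4 * √2 / (s ^ 2 + (3 + 2 * √2))) atTop (𝓝 (1 - 0)) :=
      tendsto_const_nhds.sub (tendsto_const_nhds.div_atTop h1)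
    have h4 := ((h3.log (by norm_num)).const_mul (√2 / 4))
    simp only [sub_zero, Real.log_one, mul_zero] at h4
    refine h4.congr fun s => ?_
    rw [hf]
    congr 2
    have := (hq s).ne'
    field_simp
    ring
  have hpos : ∀ s ∈ Set.Ioi (0 : ℝ), 0 ≤ 4 * s / (s ^ 4 + 6 * s ^ 2 + 1) := fun s hs => by
    have : (0 : ℝ) < s := hs
    positivity
  rw [integral_Ioi_of_hasDerivAt_of_tendsto (hd 0).continuousAt.continuousWithinAt (fun s _ => hd s)
    (integrableOn_Ioi_deriv_of_nonneg (hd 0).continuousAt.continuousWithinAt (fun s _ => hd s)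
      hpos hlim) hlim]
  have e1 : 3 - 2 * √2 = (3 + 2 * √2)⁻¹ :=
    eq_inv_of_mul_eq_one_left (by linear_combination -4 * h2)
  have e2 : ((0 : ℝ) ^ 2 + (3 - 2 * √2)) / (0 ^ 2 + (3 + 2 * √2)) = ((1 + √2) ^ 4)⁻¹ := by
    have : (1 + √2) ^ 4 = (3 + 2 * √2) * (3 + 2 * √2) := by
      linear_combination (√2 ^ 2 + 4 * √2 + 4) * h2
    rw [this, e1, mul_inv, div_eq_mul_inv]
    simp
  rw [hf]
  simp only [e2]
  rw [Real.log_inv, Real.log_pow]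
  push_cast
  ring

theorem integrable_ray : Integrable (fun q : ℝ × ℝ =>
    q.1 * (Real.sin (q.1 ^ 2 * q.2 / 2) * Real.exp (-(q.1 ^ 2 * (1 + q.2 ^ 2)) / 4)))
    ((volume.restrict (Set.Ioi (0 : ℝ))).prod (volume.restrict (Set.Ioi (0 : ℝ)))) := by
  have hr : ∀ s : ℝ, ∫ x in Set.Ioi (0 : ℝ), x * Real.exp (-(x ^ 2 * (1 + s ^ 2)) / 4) =
      2 * (1 + s ^ 2)⁻¹ := by
    intro s
    have hp : (0 : ℝ) < ((((1 + s ^ 2) / 4 : ℝ) : ℂ)).re := by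
      rw [Complex.ofReal_re]; positivity
    have h := integral_mul_cexp_neg_mul_sq hp
    have e : ∀ r : ℝ, (r : ℂ) * Complex.exp (-(((1 + s ^ 2) / 4 : ℝ) : ℂ) * (r : ℂ) ^ 2) =
        ((r * Real.exp (-(r ^ 2 * (1 + s ^ 2)) / 4) : ℝ) : ℂ) := by
      intro r
      push_cast
      ring_nf
    simp_rw [e] at h
    rw [integral_complex_ofReal] at h
    have h' : ∫ x in Set.Ioi (0 : ℝ), x * Real.exp (-(x ^ 2 * (1 + s ^ 2)) / 4) =
        (2 * ((1 + s ^ 2) / 4))⁻¹ := by exact_mod_cast h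
    rw [h']
    field_simp
    ring
  have hi : ∀ s : ℝ, IntegrableOn (fun x : ℝ => x * Real.exp (-(x ^ 2 * (1 + s ^ 2)) / 4))
      (Set.Ioi 0) := by
    intro s
    have h := integrable_mul_exp_neg_mul_sq (b := (1 + s ^ 2) / 4) (by positivity)
    refine (h.congr (Eventually.of_forall fun x => ?_)).integrableOn
    ring_nf
  have hdom : Integrable (fun q : ℝ × ℝ => q.1 * Real.exp (-(q.1 ^ 2 * (1 + q.2 ^ 2)) / 4))
      ((volume.restrict (Set.Ioi (0 : ℝ))).prod (volume.restrict (Set.Ioi (0 : ℝ)))) := by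
    rw [integrable_prod_iff' (by fun_prop)]
    refine ⟨Eventually.of_forall fun s => hi s, ?_⟩
    have e : ∀ s : ℝ, ∫ x in Set.Ioi (0 : ℝ), ‖x * Real.exp (-(x ^ 2 * (1 + s ^ 2)) / 4)‖ =
        2 * (1 + s ^ 2)⁻¹ := by
      intro s
      rw [← hr s]
      refine setIntegral_congr_fun measurableSet_Ioi fun x hx => ?_
      have : (0 : ℝ) < x := hx
      exact Real.norm_of_nonneg (by positivity)
    simp_rw [e]
    exact (integrable_inv_one_add_sq.const_mul 2).integrableOn
  refine hdom.norm.mono' (by fun_prop) (Eventually.of_forall fun q => ?_)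
  rw [norm_mul, norm_mul, norm_mul]
  gcongr
  calc _ ≤ 1 * ‖Real.exp (-(q.1 ^ 2 * (1 + q.2 ^ 2)) / 4)‖ := by
        gcongr
        exact Real.abs_sin_le_one _
    _ = _ := one_mul _

theorem integral_quadrant :
    ∫ x in Set.Ioi (0 : ℝ), ∫ y in Set.Ioi (0 : ℝ),
      Real.sin (x * y / 2) * Real.exp (-(x ^ 2 + y ^ 2) / 4) = √2 * Real.log (1 + √2) := by
  have h : ∀ x ∈ Set.Ioi (0 : ℝ), ∫ y in Set.Ioi (0 : ℝ),
      Real.sin (x * y / 2) * Real.exp (-(x ^ 2 + y ^ 2) / 4) = ∫ s in Set.Ioi (0 : ℝ),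
        x * (Real.sin (x ^ 2 * s / 2) * Real.exp (-(x ^ 2 * (1 + s ^ 2)) / 4)) := by
    intro x hx
    have hx0 : (0 : ℝ) < x := hx
    have h := integral_comp_mul_left_Ioi
      (fun y => Real.sin (x * y / 2) * Real.exp (-(x ^ 2 + y ^ 2) / 4)) 0 hx0
    rw [mul_zero, smul_eq_mul, eq_inv_mul_iff_mul_eq₀ hx0.ne'] at h
    rw [← h, ← integral_const_mul]
    congr with s
    ring_nf
  rw [setIntegral_congr_fun measurableSet_Ioi h, integral_integral_swap integrable_ray]
  simp_rw [integral_ray]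
  exact integral_rational

theorem im_integral_sign_mul_sign :
    (∫ q : ℝ × ℝ, ((Real.sign q.1 * Real.sign q.2 : ℝ) : ℂ) * tiltedGaussian q).im =
      4 * √2 * Real.log (1 + √2) := by
  have hint : Integrable fun q : ℝ × ℝ =>
      ((Real.sign q.1 * Real.sign q.2 : ℝ) : ℂ) * tiltedGaussian q := by
    refine integrable_bdd_mul_tiltedGaussian ((measurable_real_sign.comp measurable_fst).mul
      (measurable_real_sign.comp measurable_snd)) fun q => ?_
    rw [abs_mul]
    exact mul_le_one₀ (abs_real_sign_le_one _) (abs_nonneg _) (abs_real_sign_le_one _)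
  have him : (∫ q : ℝ × ℝ, ((Real.sign q.1 * Real.sign q.2 : ℝ) : ℂ) * tiltedGaussian q).im =
      ∫ q : ℝ × ℝ, (((Real.sign q.1 * Real.sign q.2 : ℝ) : ℂ) * tiltedGaussian q).im :=
    (integral_im hint).symm
  have habs : ∀ q : ℝ × ℝ, (((Real.sign q.1 * Real.sign q.2 : ℝ) : ℂ) * tiltedGaussian q).im =
      Real.sin (|q.1| * |q.2| / 2) * Real.exp (-(|q.1| ^ 2 + |q.2| ^ 2) / 4) := by
    intro q
    rw [Complex.im_ofReal_mul, tiltedGaussian, Complex.exp_add, ← Complex.ofReal_exp,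
      Complex.im_ofReal_mul, Complex.exp_ofReal_mul_I_im, sq_abs, sq_abs, ← mul_assoc,
      mul_right_comm]
    congr 1
    have hs : ∀ x : ℝ, x = 0 ∨ (Real.sign x = 1 ∧ |x| = x) ∨ (Real.sign x = -1 ∧ |x| = -x) := by
      intro x
      rcases lt_trichotomy x 0 with h | h | h
      · exact Or.inr (Or.inr ⟨Real.sign_of_neg h, abs_of_neg h⟩)
      · exact Or.inl h
      · exact Or.inr (Or.inl ⟨Real.sign_of_pos h, abs_of_pos h⟩)
    rcases hs q.1 with h1 | ⟨h1, h1'⟩ | ⟨h1, h1'⟩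
    · simp [h1]
    all_goals rcases hs q.2 with h2 | ⟨h2, h2'⟩ | ⟨h2, h2'⟩
    all_goals simp [*, neg_div, Real.sin_neg]
  rw [him, integral_congr_ae (Eventually.of_forall habs)]
  have hint2 : Integrable fun q : ℝ × ℝ =>
      Real.sin (|q.1| * |q.2| / 2) * Real.exp (-(|q.1| ^ 2 + |q.2| ^ 2) / 4) :=
    hint.im.congr (Eventually.of_forall habs)
  rw [Measure.volume_eq_prod] at hint2 ⊢
  rw [integral_prod _ hint2]
  have hinner : ∀ x : ℝ, ∫ y : ℝ, Real.sin (|x| * |y| / 2) * Real.exp (-(|x| ^ 2 + |y| ^ 2) / 4) =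
      (fun r => 2 * ∫ y in Set.Ioi (0 : ℝ), Real.sin (r * y / 2) *
        Real.exp (-(r ^ 2 + y ^ 2) / 4)) |x| := fun x =>
    integral_comp_abs (f := fun y => Real.sin (|x| * y / 2) * Real.exp (-(|x| ^ 2 + y ^ 2) / 4))
  rw [integral_congr_ae (Eventually.of_forall hinner),
    integral_comp_abs (f := fun r => 2 * ∫ y in Set.Ioi (0 : ℝ), Real.sin (r * y / 2) *
        Real.exp (-(r ^ 2 + y ^ 2) / 4)), integral_const_mul, integral_quadrant]
  ring

/-! ### Perturbed half-spaces -/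

theorem conj_tiltedGaussian (x y : ℝ) :
    (starRingEnd ℂ) (tiltedGaussian (x, y)) = tiltedGaussian (-x, y) := by
  rw [tiltedGaussian, tiltedGaussian, ← Complex.exp_conj, map_add, map_mul, Complex.conj_ofReal,
    Complex.conj_ofReal, Complex.conj_I]
  congr 1
  push_cast
  ring

theorem corrExtension_I (s : (ℝ × ℝ) × (ℝ × ℝ) → ℝ) :
    corrExtension s Complex.I = (((8 * Real.pi ^ 2)⁻¹ : ℝ) : ℂ) *
      ∫ q : (ℝ × ℝ) × (ℝ × ℝ), (s q : ℂ) * (tiltedGaussian q.1 * tiltedGaussian q.2) := by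
  have hc : (4 * (Real.pi : ℂ) ^ 2 * (1 - Complex.I ^ 2))⁻¹ = (((8 * Real.pi ^ 2)⁻¹ : ℝ) : ℂ) := by
    rw [Complex.I_sq]
    push_cast
    ring_nf
  simp only [corrExtension, hc, corrKernel_I]

/-- For odd functions the value of the extension at `i` is purely imaginary. -/
theorem corrExtension_I_re_eq_zero {s : (ℝ × ℝ) × (ℝ × ℝ) → ℝ}
    (hs : ∀ q, s ((-q.1.1, q.1.2), (-q.2.1, q.2.2)) = -s q) :
    (corrExtension s Complex.I).re = 0 := by
  have hmp : MeasurePreserving ((MeasurableEquiv.neg ℝ).prodCongr (MeasurableEquiv.refl ℝ))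
      (volume : Measure (ℝ × ℝ)) volume :=
    (Measure.measurePreserving_neg (volume : Measure ℝ)).prod (MeasurePreserving.id volume)
  have hmp2 : MeasurePreserving
      (((MeasurableEquiv.neg ℝ).prodCongr (MeasurableEquiv.refl ℝ)).prodCongr
        ((MeasurableEquiv.neg ℝ).prodCongr (MeasurableEquiv.refl ℝ)))
      (volume : Measure ((ℝ × ℝ) × (ℝ × ℝ))) volume := hmp.prod hmp
  have h := hmp2.integral_comp' 
    (g := fun q => (s q : ℂ) * (tiltedGaussian q.1 * tiltedGaussian q.2))
  have e : ∀ q : (ℝ × ℝ) × (ℝ × ℝ), (s ((-q.1.1, q.1.2), (-q.2.1, q.2.2)) : ℂ) *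
      (tiltedGaussian (-q.1.1, q.1.2) * tiltedGaussian (-q.2.1, q.2.2)) =
      -(starRingEnd ℂ) ((s q : ℂ) * (tiltedGaussian q.1 * tiltedGaussian q.2)) := by
    intro q
    rw [hs, map_mul, map_mul, ← conj_tiltedGaussian, ← conj_tiltedGaussian, Complex.conj_ofReal]
    push_cast
    ring
  have h2 : ∫ q : (ℝ × ℝ) × (ℝ × ℝ), -(starRingEnd ℂ) ((s q : ℂ) *
      (tiltedGaussian q.1 * tiltedGaussian q.2)) =
      ∫ q : (ℝ × ℝ) × (ℝ × ℝ), (s q : ℂ) * (tiltedGaussian q.1 * tiltedGaussian q.2) := by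
    rw [← h]
    exact integral_congr_ae (Eventually.of_forall fun q => (e q).symm)
  rw [integral_neg, integral_conj] at h2
  have h3 := congrArg Complex.re h2
  rw [Complex.neg_re, Complex.conj_re] at h3
  rw [corrExtension_I, Complex.re_ofReal_mul, mul_eq_zero]
  right
  linarith

theorem measurable_hermiteThree : Measurable hermiteThree := by
  unfold hermiteThree; fun_prop

/-- The sign pattern of the half-spaces `x₁ > η H₃(x₀)` and `y₁ > -η H₃(y₀)`. -/
noncomputable def perturbedSigns (η : ℝ) (q : (ℝ × ℝ) × (ℝ × ℝ)) : ℝ :=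
  Real.sign (q.2.1 - η * hermiteThree q.1.1) * Real.sign (q.2.2 - -(η * hermiteThree q.1.2))

theorem measurable_perturbedSigns (η : ℝ) : Measurable (perturbedSigns η) := by
  have h := measurable_hermiteThree
  exact (measurable_real_sign.comp (by fun_prop)).mul (measurable_real_sign.comp (by fun_prop))

theorem abs_perturbedSigns_le_one (η : ℝ) (q : (ℝ × ℝ) × (ℝ × ℝ)) : |perturbedSigns η q| ≤ 1 := by
  rw [perturbedSigns, abs_mul]
  exact mul_le_one₀ (abs_real_sign_le_one _) (abs_nonneg _) (abs_real_sign_le_one _)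

theorem integrable_perturbedSigns (η : ℝ) : Integrable fun q : (ℝ × ℝ) × (ℝ × ℝ) =>
    (perturbedSigns η q : ℂ) * (tiltedGaussian q.1 * tiltedGaussian q.2) := by
  refine (integrable_tiltedGaussian.mul_prod integrable_tiltedGaussian).bdd_mul (c := 1)
    (Complex.measurable_ofReal.comp (measurable_perturbedSigns η)).aestronglyMeasurable
    (Eventually.of_forall fun q => ?_)
  simpa using abs_perturbedSigns_le_one η q

theorem perturbedSigns_integral_right (η : ℝ) (q : ℝ × ℝ) :
    ∫ p : ℝ × ℝ, (perturbedSigns η (q, p) : ℂ) * (tiltedGaussian q * tiltedGaussian p) =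
      signMean (η * hermiteThree q.1) (-(η * hermiteThree q.2)) * tiltedGaussian q := by
  rw [signMean, ← integral_mul_const]
  refine integral_congr_ae (Eventually.of_forall fun p => ?_)
  simp only [perturbedSigns]
  ring

theorem integrable_signMean_mul (η : ℝ) : Integrable fun q : ℝ × ℝ =>
    signMean (η * hermiteThree q.1) (-(η * hermiteThree q.2)) * tiltedGaussian q := by
  have h := (integrable_perturbedSigns η).integral_prod_left
  simpa only [perturbedSigns_integral_right] using h

theorem corrExtension_perturbedSigns_I (η : ℝ) :
    corrExtension (perturbedSigns η) Complex.I = (((8 * Real.pi ^ 2)⁻¹ : ℝ) : ℂ) *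
      ∫ q : ℝ × ℝ, signMean (η * hermiteThree q.1) (-(η * hermiteThree q.2)) *
        tiltedGaussian q := by
  have h := integral_prod _ (integrable_perturbedSigns η)
  simp only [perturbedSigns_integral_right] at h
  rw [corrExtension_I, ← h]
  rfl

/-- The growth of the remainder in the expansion of `signMean` along the perturbation. -/
noncomputable def remainderBound (q : ℝ × ℝ) : ℝ :=
  |hermiteThree q.1| ^ 5 + |hermiteThree q.2| ^ 5 +
    (hermiteThree q.1 ^ 2 + hermiteThree q.2 ^ 2) ^ 2 * |hermiteThree q.1| * |hermiteThree q.2|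

theorem abs_hermiteThree_le (x y : ℝ) : |hermiteThree x| ≤ 4 * (1 + (x ^ 2 + y ^ 2)) ^ 3 := by
  have h1 := abs_le_one_add_sq_add_sq x y
  have hT : 1 ≤ 1 + (x ^ 2 + y ^ 2) := by nlinarith [sq_nonneg x, sq_nonneg y]
  set T := 1 + (x ^ 2 + y ^ 2)
  calc |hermiteThree x| ≤ |x| ^ 3 + 3 * |x| := by
        rw [hermiteThree, ← abs_pow]
        refine (abs_sub _ _).trans ?_
        rw [abs_mul, abs_of_pos (by norm_num : (0 : ℝ) < 3)]
    _ ≤ T ^ 3 + 3 * T := by gcongr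
    _ ≤ T ^ 3 + 3 * T ^ 3 := by
        gcongr
        exact le_self_pow₀ hT (by norm_num)
    _ = _ := by ring

theorem integrable_remainderBound : Integrable fun q : ℝ × ℝ =>
    remainderBound q * ‖tiltedGaussian q‖ := by
  have hm := measurable_hermiteThree
  have hmeas : Measurable remainderBound := by
    unfold remainderBound
    fun_prop
  have h := integrable_mul_tiltedGaussian (f := fun q => (remainderBound q : ℂ))
    (Complex.measurable_ofReal.comp hmeas).aestronglyMeasurable 18 20000 fun q => ?_
  · refine h.norm.congr (Eventually.of_forall fun q => ?_)
    have : 0 ≤ remainderBound q := by unfold remainderBound; positivity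
    simp only [norm_mul, Complex.norm_real]
    rw [Real.norm_of_nonneg this]
  · have h1 := abs_hermiteThree_le q.1 q.2
    have h2 := abs_hermiteThree_le q.2 q.1
    rw [add_comm (q.2 ^ 2)] at h2
    have hT : 1 ≤ 1 + (q.1 ^ 2 + q.2 ^ 2) := by nlinarith [sq_nonneg q.1, sq_nonneg q.2]
    have h0 : 0 ≤ remainderBound q := by unfold remainderBound; positivity
    rw [Complex.norm_real, Real.norm_of_nonneg h0, remainderBound, ← sq_abs (hermiteThree q.1),
      ← sq_abs (hermiteThree q.2)]
    set T := 1 + (q.1 ^ 2 + q.2 ^ 2)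
    clear_value T
    have hp : T ^ 15 ≤ T ^ 18 := pow_le_pow_right₀ hT (by norm_num)
    calc _ ≤ (4 * T ^ 3) ^ 5 + (4 * T ^ 3) ^ 5 +
          ((4 * T ^ 3) ^ 2 + (4 * T ^ 3) ^ 2) ^ 2 * (4 * T ^ 3) * (4 * T ^ 3) := by gcongr
      _ = 2048 * T ^ 15 + 16384 * T ^ 18 := by ring
      _ ≤ 2048 * T ^ 18 + 16384 * T ^ 18 := by gcongr
      _ ≤ 20000 * T ^ 18 := by linarith [pow_pos (zero_lt_one.trans_le hT) 18]

theorem exists_norm_integral_signMean_sub_le : ∃ C : ℝ, 0 ≤ C ∧ ∀ η : ℝ, 0 < η → η ≤ 1 →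
    ‖(∫ q : ℝ × ℝ, signMean (η * hermiteThree q.1) (-(η * hermiteThree q.2)) * tiltedGaussian q)
      - tiltedMoment 0 0 * (signMean 0 0 + 864 * Complex.I * η ^ 4)‖ ≤ C * η ^ 5 := by
  obtain ⟨C, hC, h⟩ := exists_norm_signMean_sub_le
  have hR0 : ∀ q, 0 ≤ remainderBound q := fun q => by unfold remainderBound; positivity
  refine ⟨C * ∫ q, remainderBound q * ‖tiltedGaussian q‖,
    mul_nonneg hC (integral_nonneg fun q => mul_nonneg (hR0 q) (norm_nonneg _)),
    fun η hη hη1 => ?_⟩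
  have hq := hasTiltedMean_signQuartic η
  have i1 := integrable_signMean_mul η
  have i2 : Integrable fun q : ℝ × ℝ => signMean 0 0 * tiltedGaussian q :=
    integrable_tiltedGaussian.const_mul _
  have i12 : Integrable fun q : ℝ × ℝ =>
      signMean (η * hermiteThree q.1) (-(η * hermiteThree q.2)) * tiltedGaussian q -
        signMean 0 0 * tiltedGaussian q := i1.sub i2
  have h0 : ∫ q : ℝ × ℝ, tiltedGaussian q = tiltedMoment 0 0 := by simp [tiltedMoment]
  have e : (∫ q : ℝ × ℝ, signMean (η * hermiteThree q.1) (-(η * hermiteThree q.2)) *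
      tiltedGaussian q) - tiltedMoment 0 0 * (signMean 0 0 + 864 * Complex.I * η ^ 4) =
      ∫ q : ℝ × ℝ, (signMean (η * hermiteThree q.1) (-(η * hermiteThree q.2)) * tiltedGaussian q -
        signMean 0 0 * tiltedGaussian q) - signQuartic ((η * hermiteThree q.1 : ℝ) : ℂ)
      ((-(η * hermiteThree q.2) : ℝ) : ℂ) * tiltedGaussian q := by
    rw [integral_sub i12 hq.1, integral_sub i1 i2, hq.2, integral_const_mul, h0]
    ring
  rw [e, mul_right_comm, ← integral_const_mul]
  refine norm_integral_le_of_norm_le (integrable_remainderBound.const_mul _)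
    (Eventually.of_forall fun q => ?_)
  rw [← sub_mul, ← sub_mul, norm_mul, ← mul_assoc]
  gcongr
  refine (h _ _).trans ?_
  rw [mul_assoc C]
  refine mul_le_mul_of_nonneg_left ?_ hC
  rw [remainderBound, abs_neg, abs_mul, abs_mul, abs_of_pos hη]
  have h6 : η ^ 6 ≤ η ^ 5 := pow_le_pow_of_le_one hη.le hη1 (by norm_num)
  calc _ = η ^ 5 * (|hermiteThree q.1| ^ 5 + |hermiteThree q.2| ^ 5) +
        η ^ 6 * ((hermiteThree q.1 ^ 2 + hermiteThree q.2 ^ 2) ^ 2 * |hermiteThree q.1| *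
          |hermiteThree q.2|) := by ring
    _ ≤ η ^ 5 * (|hermiteThree q.1| ^ 5 + |hermiteThree q.2| ^ 5) +
        η ^ 5 * ((hermiteThree q.1 ^ 2 + hermiteThree q.2 ^ 2) ^ 2 * |hermiteThree q.1| *
          |hermiteThree q.2|) := by gcongr
    _ = _ := by ring

/-- A small cubic perturbation of two half-spaces improves on the half-spaces. -/
theorem exists_lt_corrExtension_im : ∃ η : ℝ,
    2 / Real.pi * Real.log (1 + √2) < (corrExtension (perturbedSigns η) Complex.I).im := by
  obtain ⟨C, hC, h⟩ := exists_norm_integral_signMean_sub_le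
  have hpi := Real.pi_pos
  have hη0 : 0 < min 1 (1 / (C + 1)) := by positivity
  set η := min 1 (1 / (C + 1)) with hη
  have hCη : C * η < 1 := by
    calc C * η ≤ C * (1 / (C + 1)) := by gcongr; exact min_le_right _ _
      _ < 1 := by rw [mul_one_div, div_lt_one (by positivity)]; linarith
  refine ⟨η, ?_⟩
  have h1 := (Complex.abs_im_le_norm _).trans (h η hη0 (min_le_left _ _))
  have hs : (signMean 0 0).im = 4 * √2 * Real.log (1 + √2) := by
    rw [← im_integral_sign_mul_sign, signMean]
    simp only [sub_zero]
  rw [Complex.sub_im, tiltedMoment_zero_zero, Complex.im_ofReal_mul, Complex.add_im, hs] at h1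
  have e : (864 * Complex.I * (η : ℂ) ^ 4).im = 864 * η ^ 4 := by
    have : 864 * Complex.I * (η : ℂ) ^ 4 = ((864 * η ^ 4 : ℝ) : ℂ) * Complex.I := by
      push_cast; ring
    rw [this, Complex.im_ofReal_mul, Complex.I_im, mul_one]
  rw [e] at h1
  rw [corrExtension_perturbedSigns_I, Complex.im_ofReal_mul]
  set A := (∫ q : ℝ × ℝ, signMean (η * hermiteThree q.1) (-(η * hermiteThree q.2)) *
    tiltedGaussian q).im
  have h2 := (abs_le.1 h1).1
  have hη4 : 0 < η ^ 4 := by positivity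
  have h3 : C * η ^ 5 < η ^ 4 := by
    calc C * η ^ 5 = (C * η) * η ^ 4 := by ring
      _ < 1 * η ^ 4 := by gcongr
      _ = _ := one_mul _
  have hN : 1 ≤ 2 * √2 * Real.pi := by
    have : 1 ≤ √2 := Real.one_le_sqrt.2 (by norm_num)
    nlinarith [Real.pi_gt_three]
  have h4 : 16 * Real.pi * Real.log (1 + √2) < A := by
    have e2 : 2 * √2 * Real.pi * (4 * √2 * Real.log (1 + √2) + 864 * η ^ 4) =
        16 * Real.pi * Real.log (1 + √2) + 864 * (2 * √2 * Real.pi) * η ^ 4 := by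
      linear_combination (8 * Real.pi * Real.log (1 + √2)) *
        Real.sq_sqrt (show (0 : ℝ) ≤ 2 by norm_num)
    rw [e2] at h2
    have := mul_le_mul_of_nonneg_right hN hη4.le
    linarith
  calc 2 / Real.pi * Real.log (1 + √2) =
        (8 * Real.pi ^ 2)⁻¹ * (16 * Real.pi * Real.log (1 + √2)) := by
        field_simp
        ring
    _ < _ := by gcongr

/-- There are `n ≥ 1` and odd measurable `F, G : ℝⁿ → ℝ` such that `Φ_{F,G}(i) / i` is a real
number greater than `(2 / π) * ln (1 + √2)`. -/
theorem theorem1 :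
    ∃ (n : ℕ) (F G : (Fin n → ℝ) → ℝ) (Φ : ℂ → ℂ),
      1 ≤ n ∧ Measurable F ∧ Measurable G ∧
      (∀ x, F (-x) = -F x) ∧ (∀ x, G (-x) = -G x) ∧
      IsPhi F G Φ ∧
      ∃ c : ℝ, Φ Complex.I / Complex.I = (c : ℂ) ∧
        2 / Real.pi * Real.log (1 + Real.sqrt 2) < c := by
  obtain ⟨η, hη⟩ := exists_lt_corrExtension_im
  have hm := measurable_hermiteThree
  have hF : Measurable fun v : Fin 2 → ℝ => v 1 - η * hermiteThree (v 0) := by fun_prop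
  have hG : Measurable fun v : Fin 2 → ℝ => v 1 - -(η * hermiteThree (v 0)) := by fun_prop
  have hodd : ∀ x, hermiteThree (-x) = -hermiteThree x := fun x => by
    simp only [hermiteThree]; ring
  refine ⟨2, _, _, corrExtension (perturbedSigns η), by norm_num, hF, hG, fun x => ?_, fun x => ?_,
    isPhi_corrExtension hF hG, (corrExtension (perturbedSigns η) Complex.I).im, ?_, hη⟩
  · simp only [Pi.neg_apply, hodd]; ring
  · simp only [Pi.neg_apply, hodd]; ring
  · have hre := corrExtension_I_re_eq_zero (s := perturbedSigns η) fun q => by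
      simp only [perturbedSigns, hodd]
      have : -q.2.1 - η * -hermiteThree q.1.1 = -(q.2.1 - η * hermiteThree q.1.1) := by ring
      rw [this, Real.sign_neg, neg_mul]
    rw [div_eq_iff Complex.I_ne_zero]
    apply Complex.ext <;> simp [hre]
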